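/- Let $\mathbb D\subset\mathbb C$ be the open unit disc and $\mathbb T=\partial\mathbb D$ the unit circle with Lebesgue measure. Let $D=\Omega+i\mathbb R^n\subset\mathbb C^n$ be a convex tube domain, where $\Omega\subset\mathbb R^n$ is a convex domain, and assume that $D$ is taut (every sequence of holomorphic maps $\mathbb D\to D$ has a subsequence that either converges locally uniformly to a holomorphic map $\mathbb D\to D$ or is compactly divergent). Let $\varphi:\mathbb D\to D$ be a holomorphic map. For $\lambda\in\mathbb T$ write $\varphi^*(\lambda)=\lim_{r\to1^-}\varphi(r\lambda)$ for the radial limit of $\varphi$ at $\lambda$ (it exists for almost every $\lambda\in\mathbb T$), and write $z\bullet w=\sum_{j=1}^n z_jw_j$ for $z,w\in\mathbb C^n$. Then $\varphi$ is a complex geodesic for $D$, i.e. an isometry with respect to the Poincaré distance on $\mathbb D$ and the Carathéodory (pseudo)distance on $D$, if and only if there exists a map $h:\mathbb C\to\mathbb C^n$ of the form $h(\lambda)=\bar a\lambda^2+b\lambda+a$ with some $a\in\mathbb C^n$, $b\in\mathbb R^n$, such that (i) $\operatorname{Re}\left[\bar\lambda\,h(\lambda)\bullet(z-\varphi^*(\lambda))\right]<0$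 for all $z\in D$ and almost every $\lambda\in\mathbb T$ (that is, for all $z\in D$ and all $\lambda$ in a set $A\subset\mathbb T$ of full measure that does not depend on $z$), and (ii) $\operatorname{Re}\left[h(\lambda)\bullet\dfrac{\varphi(0)-\varphi(\lambda)}{\lambda}\right]<0$ for every $\lambda\in\mathbb D\setminus\{0\}$. -/

import Mathlib

open MeasureTheory Filter Topology

/-- The holomorphic maps from the unit disc of `ℂ` into `D ⊆ ℂⁿ`. -/
def IsHolomorphicDisc {n : ℕ} (D : Set (Fin n → ℂ)) (φ : ℂ → Fin n → ℂ) : Prop :=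
  DifferentiableOn ℂ φ (Metric.ball 0 1) ∧ Set.MapsTo φ (Metric.ball 0 1) D

/-- `D = Ω + iℝⁿ` for some convex domain `Ω ⊆ ℝⁿ`
(a non-empty convex open set; it is automatically connected). -/
def IsConvexTube {n : ℕ} (D : Set (Fin n → ℂ)) : Prop :=
  ∃ Ω : Set (Fin n → ℝ), IsOpen Ω ∧ Ω.Nonempty ∧ Convex ℝ Ω ∧
    D = {z | (fun j => (z j).re) ∈ Ω}

/-- `D` is taut: the family of holomorphic maps from the unit disc into `D` is normal, i.e. every
sequence in it has a subsequence that converges locally uniformly to a holomorphic map from the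
disc into `D`, or a subsequence that is compactly divergent. -/
def IsTaut {n : ℕ} (D : Set (Fin n → ℂ)) : Prop :=
  ∀ F : ℕ → ℂ → Fin n → ℂ, (∀ k, IsHolomorphicDisc D (F k)) →
    (∃ s : ℕ → ℕ, StrictMono s ∧ ∃ g : ℂ → Fin n → ℂ, IsHolomorphicDisc D g ∧
      TendstoLocallyUniformlyOn (fun k => F (s k)) g atTop (Metric.ball 0 1)) ∨
    (∃ s : ℕ → ℕ, StrictMono s ∧
      ∀ K : Set ℂ, K ⊆ Metric.ball 0 1 → IsCompact K →
      ∀ L : Set (Fin n → ℂ), L ⊆ D → IsCompact L →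
        ∀ᶠ k in atTop, Disjoint (F (s k) '' K) L)

/-- The Poincaré distance `artanh |(z - w) / (1 - w̄ z)|` of two points of the unit disc. -/
noncomputable def poincareDist (z w : ℂ) : ℝ :=
  Real.artanh ‖(z - w) / (1 - starRingEnd ℂ w * z)‖

/-- The Carathéodory (pseudo)distance of `D`: the supremum of the Poincaré distances of `f z` and
`f w` over all holomorphic functions `f` from `D` to the unit disc. -/
noncomputable def caratheodoryDist {n : ℕ} (D : Set (Fin n → ℂ)) (z w : Fin n → ℂ) : ENNReal :=
  ⨆ f : {f : (Fin n → ℂ) → ℂ // DifferentiableOn ℂ f D ∧ Set.MapsTo f D (Metric.ball 0 1)},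
    ENNReal.ofReal (poincareDist (f.1 z) (f.1 w))

/-- A holomorphic map from the unit disc into `D` that is an isometry for the Poincaré distance
and the Carathéodory (pseudo)distance. -/
def IsComplexGeodesic {n : ℕ} (D : Set (Fin n → ℂ)) (φ : ℂ → Fin n → ℂ) : Prop :=
  IsHolomorphicDisc D φ ∧
    ∀ z ∈ Metric.ball (0 : ℂ) 1, ∀ w ∈ Metric.ball (0 : ℂ) 1,
      caratheodoryDist D (φ z) (φ w) = ENNReal.ofReal (poincareDist z w)

/-- The Lebesgue (arc length) measure on the unit circle `{ζ : ‖ζ‖ = 1}`, as a measure on `ℂ`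
concentrated on the circle: the image of Lebesgue measure on `(-π, π]` under `θ ↦ exp (i θ)`. -/
noncomputable def circleLebesgue : Measure ℂ :=
  (volume.restrict (Set.Ioc (-Real.pi) Real.pi)).map (circleMap 0 1)

/-- `w` is the radial limit of `φ` at the point `ζ` of the unit circle. -/
def HasRadialLimit {n : ℕ} (φ : ℂ → Fin n → ℂ) (ζ : ℂ) (w : Fin n → ℂ) : Prop :=
  Tendsto (fun r : ℝ => φ ((r : ℂ) * ζ)) (𝓝[<] 1) (𝓝 w)

/-! Write `V_x(z) = h(z) ⬝ᵥ (x - φ z)` and `c = V_x(0)`. Both directions pass through the inequality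
`Re [conj z * (V_x(z) - c + conj c * z²)] ≤ 0` for `x ∈ D` and `z` in the disc, which says that
`V_x` is an infinitesimal generator of holomorphic self-maps of the disc.

Necessity. A normal-families argument turns equality of distances into a holomorphic `f` on `D`,
bounded by 1, with `f ∘ φ = id` (`exists_holomorphic_leftInverse`). Differentiating the Schwarz–Pick
inequality for `f ∘ (φ + t(ψ - φ))` at `t = 0` gives the generator inequality for the derivative of
`f` along `ψ - φ` (`re_conj_mul_variation_nonpos`). In a tube the competitor may be shifted by `i s
Y` with `s` an arbitrary real number, so the part linear in `s` must vanish. This forces the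
gradient of `f` along `φ` to be a self-conjugate quadratic polynomial `h`
(`exists_quadratic_gradient`). On the unit circle the terms in `c` have zero real part, so radial
limits give (i). Taking `x = φ 0` gives (ii). Strictness follows from openness of `D` and from the
maximum principle.

Tautness supplies the radial limits: the base contains no line, so the functionals bounded above on
it span the dual space, and it is enough to treat scalar functions with values in a half-plane.
These reduce to Fatou's theorem for bounded functions, obtained here by differentiating a Lipschitz
primitive along the circle.

Sufficiency. Condition (ii) bounds the real part of `(V_x(z) - c + conj c * z²) / z` from above, and
(i) makes its boundary values nonpositive in real part. Fatou's lemma for Poisson integrals then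
gives the generator inequality. For `ε > 0` the function `V_x(z) - ε z` therefore has exactly one
zero in the disc, and it is simple. This zero depends holomorphically on `x` and defines `f_ε : D →
𝔻`. The map `f_ε ∘ φ` fixes 0 with derivative `κ / (κ + ε)`, where `κ = h 0 ⬝ᵥ deriv φ 0`, so it
tends to the identity as `ε → 0`. Hence the Carathéodory distance along `φ` is at least the Poincaré
distance, and Schwarz–Pick is the other inequality. -/

open ComplexConjugate

/-! ### Möbius transformations, Schwarz–Pick and rigidity near the identity -/

/-- The Möbius transformation of the unit disc sending `a` to `0`. -/
noncomputable def discMoebius (a z : ℂ) : ℂ := (z - a) / (1 - conj a * z)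

theorem one_sub_conj_mul_ne_zero {a z : ℂ} (ha : ‖a‖ < 1) (hz : ‖z‖ ≤ 1) :
    1 - conj a * z ≠ 0 := by
  intro h
  have h1 : conj a * z = 1 := (sub_eq_zero.mp h).symm
  have h2 : ‖a‖ * ‖z‖ = 1 := by
    rw [← RCLike.norm_conj a, ← norm_mul, h1, norm_one]
  nlinarith [norm_nonneg a, norm_nonneg z]

/-- The sign of the right-hand side shows at once that Möbius transformations preserve both the open
disc and the unit circle. -/
theorem sq_norm_one_sub_conj_mul_sub (a z : ℂ) :
    ‖1 - conj a * z‖ ^ 2 - ‖z - a‖ ^ 2 = (1 - ‖a‖ ^ 2) * (1 - ‖z‖ ^ 2) := by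
  simp only [← Complex.normSq_eq_norm_sq, Complex.normSq_apply]
  simp
  ring

theorem norm_discMoebius_lt_one {a z : ℂ} (ha : ‖a‖ < 1) (hz : ‖z‖ < 1) :
    ‖discMoebius a z‖ < 1 := by
  have h0 := one_sub_conj_mul_ne_zero ha hz.le
  rw [discMoebius, norm_div, div_lt_one (norm_pos_iff.mpr h0)]
  have h := sq_norm_one_sub_conj_mul_sub a z
  have h1 : 0 < (1 - ‖a‖ ^ 2) * (1 - ‖z‖ ^ 2) := by
    apply mul_pos <;> nlinarith [norm_nonneg a, norm_nonneg z]
  exact lt_of_pow_lt_pow_left₀ 2 (norm_nonneg _) (by linarith)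

theorem differentiableOn_discMoebius {a : ℂ} (ha : ‖a‖ < 1) :
    DifferentiableOn ℂ (discMoebius a) (Metric.ball 0 1) := by
  intro z hz
  rw [mem_ball_zero_iff] at hz
  apply DifferentiableAt.differentiableWithinAt
  unfold discMoebius
  exact DifferentiableAt.div (by fun_prop) (by fun_prop) (one_sub_conj_mul_ne_zero ha hz.le)

theorem mapsTo_discMoebius {a : ℂ} (ha : ‖a‖ < 1) :
    Set.MapsTo (discMoebius a) (Metric.ball 0 1) (Metric.ball 0 1) := by
  intro z hz
  rw [mem_ball_zero_iff] at *
  exact norm_discMoebius_lt_one ha hz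

theorem discMoebius_neg_discMoebius {a z : ℂ} (ha : ‖a‖ < 1) (hz : ‖z‖ < 1) :
    discMoebius (-a) (discMoebius a z) = z := by
  have h0 := one_sub_conj_mul_ne_zero ha hz.le
  have h1 : 1 - conj a * a ≠ 0 := one_sub_conj_mul_ne_zero ha ha.le
  unfold discMoebius
  have h2 : 1 - conj (-a) * ((z - a) / (1 - conj a * z)) = (1 - conj a * a) / (1 - conj a * z) := by
    rw [map_neg, eq_div_iff h0, sub_mul, mul_assoc, div_mul_cancel₀ _ h0]
    ring
  have h3 : (z - a) / (1 - conj a * z) - -a = (1 - conj a * a) * z / (1 - conj a * z) := by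
    rw [eq_div_iff h0, sub_mul, div_mul_cancel₀ _ h0]
    ring
  rw [h2, h3, div_div_div_cancel_right₀ h0, mul_div_cancel_left₀ _ h1]

/-- The Schwarz–Pick lemma. -/
theorem norm_sub_le_of_mapsTo_ball {f : ℂ → ℂ} (hf : DifferentiableOn ℂ f (Metric.ball 0 1))
    (hm : Set.MapsTo f (Metric.ball 0 1) (Metric.ball 0 1)) {z w : ℂ} (hz : ‖z‖ < 1)
    (hw : ‖w‖ < 1) :
    ‖f z - f w‖ ≤ ‖discMoebius w z‖ * ‖1 - conj (f w) * f z‖ := by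
  have hw' : ‖-w‖ < 1 := by simpa
  have hfw : ‖f w‖ < 1 := by simpa using hm (mem_ball_zero_iff.mpr hw)
  have hfz : ‖f z‖ < 1 := by simpa using hm (mem_ball_zero_iff.mpr hz)
  have hg : DifferentiableOn ℂ (discMoebius (f w) ∘ f ∘ discMoebius (-w)) (Metric.ball 0 1) :=
    (differentiableOn_discMoebius hfw).comp
      (hf.comp (differentiableOn_discMoebius hw') (mapsTo_discMoebius hw'))
      (hm.comp (mapsTo_discMoebius hw'))
  have hgm : Set.MapsTo (discMoebius (f w) ∘ f ∘ discMoebius (-w)) (Metric.ball 0 1)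
      (Metric.closedBall 0 1) :=
    ((mapsTo_discMoebius hfw).comp (hm.comp (mapsTo_discMoebius hw'))).mono_right
      Metric.ball_subset_closedBall
  have h := Complex.norm_le_norm_of_mapsTo_ball hg hgm (by simp [discMoebius])
    (norm_discMoebius_lt_one hw hz)
  simp only [Function.comp, discMoebius_neg_discMoebius hw hz] at h
  have h0 := one_sub_conj_mul_ne_zero hfw hfz.le
  rwa [discMoebius, norm_div, div_le_iff₀ (norm_pos_iff.mpr h0)] at h

/-- The Schwarz–Pick lemma for maps into the closed disc. -/
theorem norm_sub_le_of_mapsTo_closedBall {f : ℂ → ℂ}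
    (hf : DifferentiableOn ℂ f (Metric.ball 0 1))
    (hm : Set.MapsTo f (Metric.ball 0 1) (Metric.closedBall 0 1)) {z w : ℂ} (hz : ‖z‖ < 1)
    (hw : ‖w‖ < 1) :
    ‖f z - f w‖ ≤ ‖discMoebius w z‖ * ‖1 - conj (f w) * f z‖ := by
  have key : ∀ t : ℝ, t ∈ Set.Ioo (0 : ℝ) 1 →
      ‖t * f z - t * f w‖ ≤ ‖discMoebius w z‖ * ‖1 - conj (t * f w) * (t * f z)‖ := by
    intro t ht
    refine norm_sub_le_of_mapsTo_ball (f := fun z => t * f z) (hf.const_mul _) ?_ hz hw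
    intro x hx
    have := hm hx
    rw [mem_closedBall_zero_iff] at this
    rw [mem_ball_zero_iff, norm_mul, Complex.norm_real, Real.norm_of_nonneg ht.1.le]
    nlinarith [ht.1, ht.2, norm_nonneg (f x)]
  have hT : Tendsto (fun t : ℝ => ‖t * f z - t * f w‖) (𝓝[<] 1) (𝓝 ‖f z - f w‖) := by
    have : ContinuousAt (fun t : ℝ => ‖t * f z - t * f w‖) 1 := by fun_prop
    simpa using this.tendsto.mono_left nhdsWithin_le_nhds
  have hT' : Tendsto (fun t : ℝ => ‖discMoebius w z‖ * ‖1 - conj (t * f w) * (t * f z)‖) (𝓝[<] 1)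
      (𝓝 (‖discMoebius w z‖ * ‖1 - conj (f w) * f z‖)) := by
    have : ContinuousAt
        (fun t : ℝ => ‖discMoebius w z‖ * ‖1 - conj (t * f w) * (t * f z)‖) 1 := by
      simp only [map_mul, Complex.conj_ofReal]
      fun_prop
    simpa using this.tendsto.mono_left nhdsWithin_le_nhds
  refine le_of_tendsto_of_tendsto hT hT' ?_
  filter_upwards [Ioo_mem_nhdsLT (zero_lt_one (α := ℝ))] with t ht using key t ht

/-- Holomorphic self-maps of the disc fixing `0` whose slopes at one point tend to `1` converge
pointwise to the identity. -/
theorem tendsto_self_of_tendsto_dslope {ι : Type*} {l : Filter ι} {u : ι → ℂ → ℂ} {x : ℂ}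
    (hx : ‖x‖ < 1)
    (hu : ∀ᶠ i in l, DifferentiableOn ℂ (u i) (Metric.ball 0 1) ∧
      Set.MapsTo (u i) (Metric.ball 0 1) (Metric.ball 0 1) ∧ u i 0 = 0)
    (hs : Tendsto (fun i => dslope (u i) 0 x) l (𝓝 1)) {z : ℂ} (hz : ‖z‖ < 1) :
    Tendsto (fun i => u i z) l (𝓝 z) := by
  set ρ := ‖discMoebius x z‖
  have hρ : ρ < 1 := norm_discMoebius_lt_one hx hz
  have hball : Metric.ball (0 : ℂ) 1 ∈ 𝓝 0 := Metric.ball_mem_nhds _ one_pos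
  -- Schwarz–Pick for the slope function: with `m`, `b` its values at `z`, `x`, one has `|m - b| ≤ ρ
  -- |1 - conj b * m| ≤ ρ (|1 - conj b * b| + |m - b|)`. Solving for `|m - b|` gives the factor `ρ /
  -- (1 - ρ)`.
  have key : ∀ᶠ i in l, ‖dslope (u i) 0 z - dslope (u i) 0 x‖ ≤
      ρ / (1 - ρ) * ‖1 - conj (dslope (u i) 0 x) * dslope (u i) 0 x‖ := by
    filter_upwards [hu] with i ⟨hd, hm, h0⟩
    have hmc : Set.MapsTo (u i) (Metric.ball 0 1) (Metric.closedBall (u i 0) 1) := by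
      rw [h0]; exact hm.mono_right Metric.ball_subset_closedBall
    have hdm : Set.MapsTo (dslope (u i) 0) (Metric.ball 0 1) (Metric.closedBall 0 1) := by
      intro y hy
      simpa using Complex.norm_dslope_le_div_of_mapsTo_ball hd hmc hy
    have h1 := norm_sub_le_of_mapsTo_closedBall
      ((Complex.differentiableOn_dslope hball).mpr hd) hdm hz hx
    set m := dslope (u i) 0 z
    have hb : ‖dslope (u i) 0 x‖ ≤ 1 := by
      simpa using hdm (mem_ball_zero_iff.mpr hx)
    set b := dslope (u i) 0 x
    have h2 : ‖1 - conj b * m‖ ≤ ‖1 - conj b * b‖ + ‖m - b‖ := by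
      have : 1 - conj b * m = (1 - conj b * b) - conj b * (m - b) := by ring
      rw [this]
      refine (norm_sub_le _ _).trans ?_
      rw [norm_mul, RCLike.norm_conj]
      gcongr
      nlinarith [norm_nonneg (m - b)]
    have hρ0 : 0 ≤ ρ := norm_nonneg _
    rw [div_mul_eq_mul_div, le_div_iff₀ (by linarith)]
    nlinarith
  have hlim : Tendsto (fun i => ρ / (1 - ρ) * ‖1 - conj (dslope (u i) 0 x) * dslope (u i) 0 x‖) l
      (𝓝 0) := by
    have : Tendsto (fun i => ρ / (1 - ρ) * ‖1 - conj (dslope (u i) 0 x) * dslope (u i) 0 x‖) l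
        (𝓝 (ρ / (1 - ρ) * ‖1 - conj (1 : ℂ) * 1‖)) :=
      ((tendsto_const_nhds.sub ((((Complex.continuous_conj.tendsto _).comp hs)).mul hs)).norm).const_mul _
    simpa using this
  have h3 : Tendsto (fun i => dslope (u i) 0 z - dslope (u i) 0 x) l (𝓝 0) :=
    squeeze_zero_norm' key hlim
  have h4 : Tendsto (fun i => dslope (u i) 0 z) l (𝓝 1) := by
    simpa using h3.add hs
  have h5 : Tendsto (fun i => z * dslope (u i) 0 z) l (𝓝 z) := by
    simpa using h4.const_mul z
  refine h5.congr' ?_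
  filter_upwards [hu] with i ⟨_, _, h0⟩
  have := sub_smul_dslope (u i) 0 z
  simpa [h0] using this

/-- A holomorphic function whose real part is negative on a circle has negative real part inside. -/
theorem re_neg_of_re_neg_on_sphere {g : ℂ → ℂ} {r : ℝ} (hr : 0 < r)
    (hg : DiffContOnCl ℂ g (Metric.ball 0 r))
    (hs : ∀ z, ‖z‖ = r → (g z).re < 0) {z : ℂ} (hz : ‖z‖ < r) : (g z).re < 0 := by
  have hcont : ContinuousOn (fun z => (g z).re) (Metric.sphere 0 r) := by
    refine Complex.continuous_re.comp_continuousOn (hg.continuousOn.mono ?_)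
    rw [closure_ball _ hr.ne']
    exact Metric.sphere_subset_closedBall
  obtain ⟨x, hx, hmax⟩ := (isCompact_sphere (0 : ℂ) r).exists_isMaxOn
    (NormedSpace.sphere_nonempty.mpr hr.le) hcont
  have hx' := hs x (by simpa using hx)
  -- The maximum modulus principle for `exp ∘ g`, whose modulus is `exp (Re g)`.
  have h1 : ‖Complex.exp (g z)‖ ≤ Real.exp (g x).re := by
    refine Complex.norm_le_of_forall_mem_frontier_norm_le (f := fun z => Complex.exp (g z))
      Metric.isBounded_ball (Complex.differentiable_exp.comp_diffContOnCl hg)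
      (fun y hy => ?_) (subset_closure (mem_ball_zero_iff.mpr hz))
    rw [frontier_ball _ hr.ne'] at hy
    rw [Complex.norm_exp]
    exact Real.exp_le_exp.mpr (hmax hy)
  rw [Complex.norm_exp, Real.exp_le_exp] at h1
  linarith

/-! ### Bounded holomorphic functions on normed spaces and their limits -/

/-- A locally uniform second-order Taylor estimate for bounded holomorphic functions. -/
theorem norm_sub_fderiv_le_of_bounded {E : Type*} [NormedAddCommGroup E] [NormedSpace ℂ E]
    {f : E → ℂ} {x : E} {r C : ℝ} (hr : 0 < r)
    (hf : DifferentiableOn ℂ f (Metric.ball x r)) (hC : ∀ y ∈ Metric.ball x r, ‖f y‖ ≤ C) :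
    ‖fderiv ℂ f x‖ ≤ 2 * C / r ∧ ∀ y ∈ Metric.ball x r,
      ‖f y - f x - fderiv ℂ f x (y - x)‖ ≤ 4 * C / r ^ 2 * ‖y - x‖ ^ 2 := by
  have hx : x ∈ Metric.ball x r := Metric.mem_ball_self hr
  have hfx : DifferentiableAt ℂ f x := hf.differentiableAt (Metric.ball_mem_nhds _ hr)
  have hm : Set.MapsTo f (Metric.ball x r) (Metric.closedBall (f x) (2 * C)) := by
    intro y hy
    rw [Metric.mem_closedBall, dist_eq_norm]
    linarith [norm_sub_le (f y) (f x), hC y hy, hC x hx]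
  have h1 : ‖fderiv ℂ f x‖ ≤ 2 * C / r := Complex.norm_fderiv_le_div_of_mapsTo_ball hf hm hr
  refine ⟨h1, fun y hy => ?_⟩
  have hg : DifferentiableOn ℂ (fun y => f y - f x - fderiv ℂ f x (y - x)) (Metric.ball x r) := by
    fun_prop
  have hgm : Set.MapsTo (fun y => f y - f x - fderiv ℂ f x (y - x)) (Metric.ball x r)
      (Metric.closedBall ((fun y => f y - f x - fderiv ℂ f x (y - x)) x) (4 * C)) := by
    intro y hy
    have h2 : ‖fderiv ℂ f x (y - x)‖ ≤ 2 * C := by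
      refine ((fderiv ℂ f x).le_opNorm _).trans ?_
      have hy' : ‖y - x‖ ≤ r := by
        rw [← dist_eq_norm]; exact (Metric.mem_ball.mp hy).le
      calc ‖fderiv ℂ f x‖ * ‖y - x‖ ≤ 2 * C / r * r := by gcongr; exact (norm_nonneg _).trans h1
        _ = 2 * C := by field_simp
    have h3 := hm hy
    rw [Metric.mem_closedBall, dist_eq_norm] at h3
    simp only [sub_self, map_zero, mem_closedBall_zero_iff]
    linarith [norm_sub_le (f y - f x) (fderiv ℂ f x (y - x))]
  -- The remainder is bounded by `4 * C` and vanishes to second order at `x`, so the Schwarz lemma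
  -- for a multiple zero makes it quadratically small.
  have h := Complex.dist_le_mul_div_pow_of_mapsTo_ball_of_isLittleO (n := 1) hg hgm ?_ hy
  · simp only [sub_self, map_zero, dist_zero_right] at h
    refine h.trans_eq ?_
    rw [dist_eq_norm, one_add_one_eq_two, div_pow]
    field_simp
  · have := hasFDerivAt_iff_isLittleO.mp hfx.hasFDerivAt
    simpa using this.norm_right

/-- Pointwise limits of locally bounded holomorphic functions are holomorphic. -/
theorem differentiableAt_of_tendsto_of_bounded {E : Type*} [NormedAddCommGroup E]
    [NormedSpace ℂ E] [FiniteDimensional ℂ E] {ι : Type*} {l : Filter ι} [l.NeBot]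
    {F : ι → E → ℂ} {f : E → ℂ} {x : E} {r C : ℝ} (hr : 0 < r)
    (hF : ∀ᶠ i in l, DifferentiableOn ℂ (F i) (Metric.ball x r) ∧
      ∀ y ∈ Metric.ball x r, ‖F i y‖ ≤ C)
    (hf : ∀ y ∈ Metric.ball x r, Tendsto (fun i => F i y) l (𝓝 (f y))) :
    DifferentiableAt ℂ f x := by
  have hle := Ultrafilter.of_le l
  set U := Ultrafilter.of l
  have : ProperSpace (E →L[ℂ] ℂ) := FiniteDimensional.proper ℂ _
  -- The derivatives at `x` are bounded, so they have a limit `L` along an ultrafilter. The uniform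
  -- Taylor estimate passes to the limit and makes `L` the derivative of `f`.
  obtain ⟨L, -, hL⟩ := (isCompact_closedBall (0 : E →L[ℂ] ℂ) (2 * C / r)).ultrafilter_le_nhds'
    (U.map fun i => fderiv ℂ (F i) x) (by
      rw [Ultrafilter.mem_map]
      refine hle ?_
      filter_upwards [hF] with i ⟨hd, hC⟩
      simpa using (norm_sub_fderiv_le_of_bounded hr hd hC).1)
  have hL' : Tendsto (fun i => fderiv ℂ (F i) x) U (𝓝 L) := hL
  have key : ∀ y ∈ Metric.ball x r,
      ‖f y - f x - L (y - x)‖ ≤ 4 * C / r ^ 2 * ‖y - x‖ ^ 2 := by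
    intro y hy
    have h1 : Tendsto (fun i => ‖F i y - F i x - fderiv ℂ (F i) x (y - x)‖) U
        (𝓝 ‖f y - f x - L (y - x)‖) :=
      ((((hf y hy).mono_left hle).sub ((hf x (Metric.mem_ball_self hr)).mono_left hle)).sub
        (((ContinuousLinearMap.apply ℂ ℂ (y - x)).continuous.tendsto L).comp hL')).norm
    refine le_of_tendsto h1 (hle ?_)
    filter_upwards [hF] with i ⟨hd, hC⟩
    exact (norm_sub_fderiv_le_of_bounded hr hd hC).2 y hy
  have hO : (fun y => f y - f x - L (y - x)) =O[𝓝 x] fun y => ‖y - x‖ ^ 2 := by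
    refine Asymptotics.IsBigO.of_bound (4 * C / r ^ 2) ?_
    filter_upwards [Metric.ball_mem_nhds x hr] with y hy
    simpa using key y hy
  have ho : (fun y => ‖y - x‖ ^ 2) =o[𝓝 x] fun y => y - x := by
    have h0 : Tendsto (fun y => y - x) (𝓝 x) (𝓝 0) := by
      have : ContinuousAt (fun y => y - x) x := by fun_prop
      simpa using this.tendsto
    exact (Asymptotics.isLittleO_norm_pow_id one_lt_two).comp_tendsto h0
  exact (hasFDerivAt_iff_isLittleO.mpr (hO.trans_isLittleO ho)).differentiableAt

/-- The derivative of a holomorphic function in a fixed direction along a holomorphic disc is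
holomorphic. -/
theorem differentiableOn_fderiv_comp_apply {E : Type*} [NormedAddCommGroup E]
    [NormedSpace ℂ E] {D : Set E} (hD : IsOpen D) {f : E → ℂ}
    (hf : DifferentiableOn ℂ f D) (hb : ∀ x ∈ D, ‖f x‖ ≤ 1) {φ : ℂ → E}
    (hφ : DifferentiableOn ℂ φ (Metric.ball 0 1)) (hm : Set.MapsTo φ (Metric.ball 0 1) D) (v : E) :
    DifferentiableOn ℂ (fun z => fderiv ℂ f (φ z) v) (Metric.ball 0 1) := by
  intro z hz
  refine DifferentiableAt.differentiableWithinAt ?_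
  obtain ⟨ρ, hρ, hρD⟩ := Metric.isOpen_iff.mp hD (φ z) (hm hz)
  have hcont : ContinuousAt φ z := hφ.continuousOn.continuousAt (Metric.isOpen_ball.mem_nhds hz)
  obtain ⟨r, hr, hrb⟩ := Metric.mem_nhds_iff.mp (Filter.inter_mem
    (hcont.preimage_mem_nhds (Metric.ball_mem_nhds (φ z) (half_pos hρ)))
    (Metric.isOpen_ball.mem_nhds hz))
  have hsub : ∀ y ∈ Metric.ball z r, Metric.ball (φ y) (ρ / 2) ⊆ D := by
    intro y hy
    refine (Metric.ball_subset_ball' ?_).trans hρD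
    have := (hrb hy).1
    simp only [Set.mem_preimage, Metric.mem_ball] at this
    linarith
  have hmem : ∀ᶠ s in 𝓝[≠] (0 : ℂ), s ≠ 0 ∧ ‖s • v‖ < ρ / 2 := by
    refine (eventually_mem_nhdsWithin).and (eventually_nhdsWithin_of_eventually_nhds ?_)
    have : ContinuousAt (fun s : ℂ => ‖s • v‖) 0 := by fun_prop
    exact this.eventually_lt continuousAt_const (by simpa using half_pos hρ)
  -- The derivative is a pointwise limit of difference quotients in `s`, each holomorphic in `y` and
  -- all bounded by the Schwarz lemma.
  refine differentiableAt_of_tendsto_of_bounded (l := 𝓝[≠] (0 : ℂ))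
    (F := fun s y => s⁻¹ • (f (φ y + s • v) - f (φ y))) (r := r)
    (C := 2 / (ρ / 2) * ‖v‖) hr ?_ ?_
  · filter_upwards [hmem] with s ⟨hs, hsv⟩
    have hsD : ∀ y ∈ Metric.ball z r, φ y + s • v ∈ D := fun y hy =>
      hsub y hy (by simpa [Metric.mem_ball, dist_eq_norm] using hsv)
    have hφr : DifferentiableOn ℂ φ (Metric.ball z r) := hφ.mono fun y hy => (hrb hy).2
    constructor
    · have h1 : DifferentiableOn ℂ (fun y => f (φ y + s • v)) (Metric.ball z r) :=
        hf.comp (hφr.add_const _) hsD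
      have h2 : DifferentiableOn ℂ (fun y => f (φ y)) (Metric.ball z r) :=
        hf.comp hφr fun y hy => hm (hrb hy).2
      exact (h1.sub h2).const_smul (s⁻¹ : ℂ)
    · intro y hy
      have h := Complex.dist_le_div_mul_dist_of_mapsTo_ball (R₂ := 2) (hf.mono (hsub y hy))
        (fun w hw => by
          rw [Metric.mem_closedBall, dist_eq_norm]
          linarith [norm_sub_le (f w) (f (φ y)), hb w (hsub y hy hw), hb _ (hm (hrb hy).2)])
        (z := φ y + s • v) (by simpa using hsv)
      rw [dist_eq_norm, dist_eq_norm, add_sub_cancel_left, norm_smul] at h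
      rw [norm_smul, norm_inv, inv_mul_le_iff₀ (norm_pos_iff.mpr hs)]
      linarith
  · intro y hy
    have hd : HasFDerivAt f (fderiv ℂ f (φ y)) (φ y) :=
      (hf.differentiableAt (hD.mem_nhds (hm (hrb hy).2))).hasFDerivAt
    have := (hd.hasLineDerivAt v).tendsto_slope_zero
    exact this

/-! ### Maximum principles for real parts -/

theorem isPreconnected_ball_zero_one : IsPreconnected (Metric.ball (0 : ℂ) 1) :=
  (convex_ball 0 1).isPreconnected

theorem zero_mem_ball_zero_one : (0 : ℂ) ∈ Metric.ball (0 : ℂ) 1 := Metric.mem_ball_self one_pos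

/-- A holomorphic function on the disc with vanishing real part is constant. -/
theorem eq_of_re_eq_zero {g : ℂ → ℂ} (hg : DifferentiableOn ℂ g (Metric.ball 0 1))
    (h0 : ∀ z ∈ Metric.ball 0 1, (g z).re = 0) {z : ℂ} (hz : z ∈ Metric.ball 0 1) :
    g z = g 0 := by
  have hne : ∀ z ∈ Metric.ball 0 1, 1 - g z ≠ 0 := by
    intro z hz h
    have := congrArg Complex.re h
    simp [h0 z hz] at this
  -- The Cayley transform sends the imaginary axis into the unit circle, so constant modulus forces
  -- constancy.
  have hd : DifferentiableOn ℂ (fun z => (1 + g z) / (1 - g z)) (Metric.ball 0 1) :=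
    (hg.const_add 1).div (hg.const_sub 1) hne
  have hn : ∀ z ∈ Metric.ball 0 1, ‖(1 + g z) / (1 - g z)‖ = 1 := by
    intro z hz
    rw [norm_div, div_eq_one_iff_eq (norm_ne_zero_iff.mpr (hne z hz))]
    simp [Complex.norm_def, Complex.normSq_apply, h0 z hz]
  have h := Complex.eqOn_of_isPreconnected_of_isMaxOn_norm isPreconnected_ball_zero_one
    Metric.isOpen_ball hd zero_mem_ball_zero_one
    (fun z hz => by simp only [Function.comp, Set.mem_ofPred_eq, hn z hz, hn 0 zero_mem_ball_zero_one]; exact le_rfl) hz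
  simp only [Function.const] at h
  rw [div_eq_div_iff (hne z hz) (hne 0 zero_mem_ball_zero_one)] at h
  linear_combination h / 2

/-- The strong maximum principle for the real part of a holomorphic function on the disc. -/
theorem re_neg_of_re_nonpos {g : ℂ → ℂ} (hg : DifferentiableOn ℂ g (Metric.ball 0 1))
    (h0 : ∀ z ∈ Metric.ball 0 1, (g z).re ≤ 0) {w : ℂ} (hw : w ∈ Metric.ball 0 1)
    (hw0 : (g w).re < 0) {z : ℂ} (hz : z ∈ Metric.ball 0 1) : (g z).re < 0 := by
  refine lt_of_le_of_ne (h0 z hz) fun h => ?_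
  have h1 := Complex.norm_eqOn_of_isPreconnected_of_isMaxOn (f := fun z => Complex.exp (g z))
    isPreconnected_ball_zero_one Metric.isOpen_ball hg.cexp hz
    (fun y hy => by
      simp only [Function.comp, Set.mem_ofPred_eq, Complex.norm_exp, h]
      exact Real.exp_le_exp.mpr (h0 y hy)) hw
  simp only [Function.comp, Function.const, Complex.norm_exp, h, Real.exp_eq_exp] at h1
  linarith

/-! ### Left inverses: first variation and existence -/

/-- First-order consequence of the Schwarz–Pick lemma for a bounded function with a right inverse:
variations of the right inverse are infinitesimal generators on the disc. -/
theorem re_conj_mul_variation_nonpos {E : Type*} [NormedAddCommGroup E] [NormedSpace ℂ E]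
    {D : Set E} (hD : IsOpen D) (hDc : Convex ℝ D) {f : E → ℂ} (hf : DifferentiableOn ℂ f D)
    (hb : ∀ x ∈ D, ‖f x‖ ≤ 1) {φ ψ : ℂ → E} (hφ : DifferentiableOn ℂ φ (Metric.ball 0 1))
    (hφm : Set.MapsTo φ (Metric.ball 0 1) D) (hψ : DifferentiableOn ℂ ψ (Metric.ball 0 1))
    (hψm : Set.MapsTo ψ (Metric.ball 0 1) D) (hfφ : ∀ z ∈ Metric.ball 0 1, f (φ z) = z)
    {z : ℂ} (hz : z ∈ Metric.ball 0 1) :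
    (conj z * (fderiv ℂ f (φ z) (ψ z - φ z) - fderiv ℂ f (φ 0) (ψ 0 - φ 0) +
      conj (fderiv ℂ f (φ 0) (ψ 0 - φ 0)) * z ^ 2)).re ≤ 0 := by
  have h0 := zero_mem_ball_zero_one
  have hA : ∀ y ∈ Metric.ball (0 : ℂ) 1,
      HasDerivAt (fun t : ℝ => f (φ y + t • (ψ y - φ y))) (fderiv ℂ f (φ y) (ψ y - φ y)) 0 := by
    intro y hy
    exact ((hf.differentiableAt (hD.mem_nhds (hφm hy))).hasFDerivAt.restrictScalars
      ℝ).hasLineDerivAt (ψ y - φ y)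
  have hA1 := hA z hz
  have hB1 := hA 0 h0
  set V := fderiv ℂ f (φ z) (ψ z - φ z)
  set c := fderiv ℂ f (φ 0) (ψ 0 - φ 0)
  set A := fun t : ℝ => f (φ z + t • (ψ z - φ z)) with hAdef
  set B := fun t : ℝ => f (φ 0 + t • (ψ 0 - φ 0)) with hBdef
  have hA0 : A 0 = z := by simp [hAdef, hfφ z hz]
  have hB0 : B 0 = 0 := by simp [hBdef, hfφ 0 h0]
  have hBc : HasDerivAt (fun t => conj (B t)) (conj c) 0 := by
    simpa using hB1.star
  -- The difference of the two squared sides of Schwarz–Pick, at `z` and `0`, is nonnegative for `t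
  -- > 0` and zero at `t = 0`. Its derivative there is therefore nonnegative, which is the claim up
  -- to a factor `-2`.
  have hS : HasDerivAt (fun t => ‖z‖ ^ 2 * ‖1 - conj (B t) * A t‖ ^ 2 - ‖A t - B t‖ ^ 2)
      (‖z‖ ^ 2 * (2 * inner ℝ (1 - conj (B 0) * A 0) (-(conj c * A 0 + conj (B 0) * V)))
        - 2 * inner ℝ (A 0 - B 0) (V - c)) 0 :=
    (((hBc.mul hA1).const_sub 1).norm_sq.const_mul _).sub (hA1.sub hB1).norm_sq
  have hpos : ∀ᶠ t : ℝ in 𝓝[>] 0,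
      0 ≤ ‖z‖ ^ 2 * ‖1 - conj (B t) * A t‖ ^ 2 - ‖A t - B t‖ ^ 2 := by
    filter_upwards [Ioo_mem_nhdsGT (zero_lt_one (α := ℝ))] with t ht
    have hgd : DifferentiableOn ℂ (fun y => φ y + (t : ℂ) • (ψ y - φ y)) (Metric.ball 0 1) :=
      hφ.add ((hψ.sub hφ).const_smul (t : ℂ))
    have hgm : Set.MapsTo (fun y => φ y + (t : ℂ) • (ψ y - φ y)) (Metric.ball 0 1) D := by
      intro y hy
      have := hDc.add_smul_sub_mem (hφm hy) (hψm hy) ⟨ht.1.le, ht.2.le⟩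
      simpa only [Complex.coe_smul] using this
    have h := norm_sub_le_of_mapsTo_closedBall (f := fun y => f (φ y + (t : ℂ) • (ψ y - φ y)))
      (hf.comp hgd hgm) (fun y hy => by simpa using hb _ (hgm hy)) (mem_ball_zero_iff.mp hz)
      (w := 0) (by simp)
    simp only [Complex.coe_smul] at h
    have h2 : ‖A t - B t‖ ≤ ‖z‖ * ‖1 - conj (B t) * A t‖ := by simpa [discMoebius] using h
    have h3 := pow_le_pow_left₀ (norm_nonneg _) h2 2
    rw [mul_pow] at h3
    linarith
  have hslope := (hasDerivWithinAt_iff_tendsto_slope' (by simp)).mp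
    (hS.hasDerivWithinAt (s := Set.Ioi 0))
  have hge := ge_of_tendsto (b := 0) hslope (by
    filter_upwards [hpos, self_mem_nhdsWithin] with t ht ht0
    have ht0' : (0 : ℝ) < t := ht0
    rw [slope_def_field]
    refine div_nonneg ?_ (by linarith)
    simpa [hA0, hB0] using ht)
  simp only [hA0, hB0, Complex.inner] at hge
  simp at hge
  have e1 : ‖z‖ ^ 2 = z.re * z.re + z.im * z.im := by
    rw [← Complex.normSq_eq_norm_sq, Complex.normSq_apply]
  rw [e1] at hge
  simp [pow_two]
  nlinarith [hge]

theorem norm_discMoebius_eq (z w : ℂ) :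
    ‖discMoebius z w‖ = ‖(z - w) / (1 - conj w * z)‖ := by
  rw [discMoebius, norm_div, norm_div, norm_sub_rev w z, ← RCLike.norm_conj (1 - conj z * w)]
  simp [mul_comm]

theorem poincareDist_eq_artanh (z w : ℂ) :
    poincareDist z w = Real.artanh ‖discMoebius z w‖ := by
  rw [poincareDist, norm_discMoebius_eq]

/-- Almost extremal functions for the Carathéodory distance, normalized along a disc. -/
theorem exists_normalized_almost_extremal {n : ℕ} {D : Set (Fin n → ℂ)} {φ : ℂ → Fin n → ℂ}
    (hφ : IsHolomorphicDisc D φ)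
    (h : caratheodoryDist D (φ 0) (φ (1 / 2)) = ENNReal.ofReal (poincareDist 0 (1 / 2)))
    {η : ℝ} (hη0 : 0 ≤ η) (hη : η < 1 / 2) :
    ∃ g : (Fin n → ℂ) → ℂ, DifferentiableOn ℂ g D ∧ Set.MapsTo g D (Metric.ball 0 1) ∧
      g (φ 0) = 0 ∧ ∃ q : ℝ, g (φ (1 / 2)) = q ∧ η < q ∧ q ≤ 1 / 2 := by
  have hhalf : (1 / 2 : ℂ) ∈ Metric.ball (0 : ℂ) 1 := by norm_num
  have hp : poincareDist 0 (1 / 2) = Real.artanh (1 / 2) := by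
    rw [poincareDist_eq_artanh]; norm_num [discMoebius]
  have h1 : ENNReal.ofReal (Real.artanh η) < caratheodoryDist D (φ 0) (φ (1 / 2)) := by
    rw [h, hp, ENNReal.ofReal_lt_ofReal_iff (Real.artanh_pos (by norm_num))]
    exact Real.artanh_lt_artanh (by linarith) (by norm_num) hη
  obtain ⟨⟨f, hf, hfm⟩, h2⟩ := lt_iSup_iff.mp h1
  simp only [poincareDist_eq_artanh] at h2
  have h3 := ENNReal.lt_ofReal_iff_toReal_lt (by simp) |>.mp h2
  rw [ENNReal.toReal_ofReal (Real.artanh_nonneg hη0)] at h3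
  have ha : ‖f (φ 0)‖ < 1 := by simpa using hfm (hφ.2 zero_mem_ball_zero_one)
  have hb : ‖f (φ (1 / 2))‖ < 1 := by simpa using hfm (hφ.2 hhalf)
  have hlt1 := norm_discMoebius_lt_one ha hb
  have hηq : η < ‖discMoebius (f (φ 0)) (f (φ (1 / 2)))‖ :=
    (Real.artanh_lt_artanh_iff ⟨by linarith, by linarith⟩
      ⟨by linarith [norm_nonneg (discMoebius (f (φ 0)) (f (φ (1 / 2))))], hlt1⟩).mp h3
  have hle : ‖discMoebius (f (φ 0)) (f (φ (1 / 2)))‖ ≤ 1 / 2 := by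
    have hz : ‖(1 / 2 : ℂ)‖ < 1 := by norm_num
    have h5 := norm_sub_le_of_mapsTo_ball (f := fun z => f (φ z)) (hf.comp hφ.1 hφ.2)
      (hfm.comp hφ.2) hz (w := 0) (by simp)
    rw [discMoebius, norm_div,
      div_le_iff₀ (norm_pos_iff.mpr (one_sub_conj_mul_ne_zero ha hb.le))]
    simpa [discMoebius] using h5
  set m := discMoebius (f (φ 0)) (f (φ (1 / 2)))
  have hm0 : (‖m‖ : ℂ) ≠ 0 := by
    exact_mod_cast (lt_of_le_of_lt hη0 hηq).ne'
  have hc : ‖conj m / ‖m‖‖ = 1 := by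
    rw [norm_div, RCLike.norm_conj, Complex.norm_real, norm_norm, div_self]
    exact_mod_cast hm0
  -- The Möbius factor moves the value at `φ 0` to 0. The unimodular constant then rotates the value
  -- at `φ (1 / 2)` onto the positive axis.
  refine ⟨fun x => conj m / ‖m‖ * discMoebius (f (φ 0)) (f x),
    ((differentiableOn_discMoebius ha).comp hf hfm).const_mul _, fun x hx => ?_,
    by simp [discMoebius], ‖m‖, ?_, hηq, hle⟩
  · rw [mem_ball_zero_iff, norm_mul, hc, one_mul]
    exact norm_discMoebius_lt_one ha (by simpa using hfm hx)
  · change conj m / ‖m‖ * m = ‖m‖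
    rw [div_mul_eq_mul_div, div_eq_iff hm0, mul_comm, Complex.mul_conj', pow_two]

/-- A disc attaining the Carathéodory distance of a pair of its points has a holomorphic left
inverse. -/
theorem exists_holomorphic_leftInverse {n : ℕ} {D : Set (Fin n → ℂ)} (hD : IsOpen D)
    {φ : ℂ → Fin n → ℂ} (hφ : IsHolomorphicDisc D φ)
    (h : caratheodoryDist D (φ 0) (φ (1 / 2)) = ENNReal.ofReal (poincareDist 0 (1 / 2))) :
    ∃ f : (Fin n → ℂ) → ℂ, DifferentiableOn ℂ f D ∧ (∀ x ∈ D, ‖f x‖ ≤ 1) ∧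
      ∀ z ∈ Metric.ball 0 1, f (φ z) = z := by
  -- The shift to `k + 1` keeps the lower bound `1/2 - 1/(k+2)` nonnegative already at `k = 0`.
  have hη : ∀ k : ℕ, ∃ g : (Fin n → ℂ) → ℂ, DifferentiableOn ℂ g D ∧
      Set.MapsTo g D (Metric.ball 0 1) ∧ g (φ 0) = 0 ∧
      ∃ q : ℝ, g (φ (1 / 2)) = q ∧ 1 / 2 - 1 / ((k + 1 : ℕ) + 1 : ℝ) < q ∧ q ≤ 1 / 2 := by
    intro k
    refine exists_normalized_almost_extremal hφ h ?_ ?_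
    · rw [sub_nonneg]
      apply one_div_le_one_div_of_le (by norm_num)
      push_cast
      linarith [(Nat.cast_nonneg k : (0 : ℝ) ≤ k)]
    · linarith [Nat.one_div_pos_of_nat (α := ℝ) (n := k + 1)]
  choose g hgd hgm hg0 q hgq hqlo hqhi using hη
  have hq : Tendsto q atTop (𝓝 (1 / 2)) := by
    refine tendsto_of_tendsto_of_tendsto_of_le_of_le (g := fun k : ℕ => 1 / 2 - 1 / ((k + 1 : ℕ) + 1 : ℝ))
      ?_ tendsto_const_nhds (fun k => (hqlo k).le) hqhi
    have := (tendsto_one_div_add_atTop_nhds_zero_nat (𝕜 := ℝ)).comp (tendsto_add_atTop_nat 1)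
    simpa [Function.comp_def] using this.const_sub (2⁻¹ : ℝ)
  set U : Ultrafilter ℕ := Ultrafilter.of atTop
  have hU : (U : Filter ℕ) ≤ atTop := Ultrafilter.of_le _
  have hlim : ∀ x, ∃ y, x ∈ D → Tendsto (fun k => g k x) U (𝓝 y) := by
    intro x
    by_cases hx : x ∈ D
    · obtain ⟨y, -, hy⟩ := (isCompact_closedBall (0 : ℂ) 1).ultrafilter_le_nhds'
        (U.map fun k => g k x) (by
          rw [Ultrafilter.mem_map]
          exact Filter.univ_mem' fun k => Metric.ball_subset_closedBall (hgm k hx))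
      exact ⟨y, fun _ => hy⟩
    · exact ⟨0, fun h => absurd h hx⟩
  choose f hf using hlim
  refine ⟨f, fun x hx => DifferentiableAt.differentiableWithinAt ?_, fun x hx => ?_,
    fun z hz => ?_⟩
  · obtain ⟨r, hr, hrD⟩ := Metric.isOpen_iff.mp hD x hx
    refine differentiableAt_of_tendsto_of_bounded (l := (U : Filter ℕ)) (F := g) (C := 1) hr
      (Filter.Eventually.of_forall fun k => ⟨(hgd k).mono hrD, fun y hy => ?_⟩)
      fun y hy => hf y (hrD hy)
    exact (mem_ball_zero_iff.mp (hgm k (hrD hy))).le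
  · exact le_of_tendsto (hf x hx).norm
      (Filter.Eventually.of_forall fun k => (mem_ball_zero_iff.mp (hgm k hx)).le)
  · have h1 : Tendsto (fun k => g k (φ z)) U (𝓝 z) := by
      refine tendsto_self_of_tendsto_dslope (u := fun k z => g k (φ z)) (x := 1 / 2)
        (by norm_num) (Filter.Eventually.of_forall fun k =>
          ⟨(hgd k).comp hφ.1 hφ.2, (hgm k).comp hφ.2, hg0 k⟩) ?_ (by simpa using hz)
      have h2 : ∀ k, dslope (fun z => g k (φ z)) 0 (1 / 2) = ((q k / (1 / 2) : ℝ) : ℂ) := by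
        intro k
        rw [dslope_of_ne _ (by norm_num), slope_def_field, hgq, hg0]
        push_cast
        ring
      simp only [h2]
      have h3 : Tendsto (fun k => q k / (1 / 2)) U (𝓝 1) := by
        simpa using (hq.mono_left hU).div_const (1 / 2)
      exact (Complex.continuous_ofReal.tendsto 1).comp h3
    exact tendsto_nhds_unique (hf _ (hφ.2 hz)) h1

/-! ### Convex tubes and the quadratic form of the gradient -/

theorem IsConvexTube.isOpen {n : ℕ} {D : Set (Fin n → ℂ)} (hD : IsConvexTube D) : IsOpen D := by
  obtain ⟨Ω, hΩ, -, -, rfl⟩ := hD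
  exact hΩ.preimage (by fun_prop : Continuous fun (z : Fin n → ℂ) (j : Fin n) => (z j).re)

theorem IsConvexTube.convex {n : ℕ} {D : Set (Fin n → ℂ)} (hD : IsConvexTube D) :
    Convex ℝ D := by
  obtain ⟨Ω, -, -, hΩ, rfl⟩ := hD
  intro x hx y hy s t hs ht hst
  have := hΩ hx hy hs ht hst
  simp only [Set.mem_ofPred_eq] at *
  convert this using 1
  ext j
  simp

/-- The parameter `s` has either sign and any size. This is what upgrades the variation inequality
to an equality. -/
theorem IsConvexTube.add_I_smul_mem {n : ℕ} {D : Set (Fin n → ℂ)} (hD : IsConvexTube D)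
    {x : Fin n → ℂ} (hx : x ∈ D) (s : ℝ) (Y : Fin n → ℝ) :
    x + s • (Complex.I • fun j => (Y j : ℂ)) ∈ D := by
  obtain ⟨Ω, -, -, -, rfl⟩ := hD
  simpa using hx

/-- The derivative of a holomorphic left inverse in a real direction is a self-conjugate quadratic
polynomial along the disc. -/
theorem exists_quadratic_of_leftInverse {n : ℕ} {D : Set (Fin n → ℂ)} (hD : IsConvexTube D)
    {φ : ℂ → Fin n → ℂ} (hφ : IsHolomorphicDisc D φ) {f : (Fin n → ℂ) → ℂ}
    (hf : DifferentiableOn ℂ f D) (hb : ∀ x ∈ D, ‖f x‖ ≤ 1)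
    (hfφ : ∀ z ∈ Metric.ball 0 1, f (φ z) = z) (Y : Fin n → ℝ) :
    ∃ (α : ℂ) (β : ℝ), ∀ z ∈ Metric.ball (0 : ℂ) 1,
      fderiv ℂ f (φ z) (fun j => (Y j : ℂ)) = conj α * z ^ 2 + β * z + α := by
  set v : Fin n → ℂ := fun j => (Y j : ℂ)
  set T : ℂ → ℂ := fun z => fderiv ℂ f (φ z) (Complex.I • v) with hT
  have h0 := zero_mem_ball_zero_one
  have hTd : DifferentiableOn ℂ T (Metric.ball 0 1) :=
    differentiableOn_fderiv_comp_apply hD.isOpen hf hb hφ.1 hφ.2 _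
  have hQ : ∀ z ∈ Metric.ball (0 : ℂ) 1,
      (conj z * (T z - T 0 + conj (T 0) * z ^ 2)).re = 0 := by
    intro z hz
    have key : ∀ s : ℝ, (conj z * fderiv ℂ f (φ z) (φ 0 - φ z)).re +
        s * (conj z * (T z - T 0 + conj (T 0) * z ^ 2)).re ≤ 0 := by
      intro s
      have h := re_conj_mul_variation_nonpos hD.isOpen hD.convex hf hb hφ.1 hφ.2
        (ψ := fun _ => φ 0 + s • (Complex.I • v)) (differentiableOn_const _)
        (fun _ _ => hD.add_I_smul_mem (hφ.2 h0) s Y) hfφ hz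
      have e : ∀ y, φ 0 + s • (Complex.I • v) - φ y =
          (φ 0 - φ y) + (s : ℂ) • (Complex.I • v) := fun y => by
        rw [Complex.coe_smul]; abel
      have e3 : ∀ y, fderiv ℂ f (φ y) (φ 0 + s • (Complex.I • v) - φ y) =
          fderiv ℂ f (φ y) (φ 0 - φ y) + (s : ℂ) • T y := fun y => by
        rw [e, map_add, map_smul]
      rw [e3, e3, sub_self, map_zero, zero_add] at h
      have e2 : conj z * (fderiv ℂ f (φ z) (φ 0 - φ z) + (s : ℂ) • T z - (s : ℂ) • T 0 +
        conj ((s : ℂ) • T 0) * z ^ 2) = conj z * fderiv ℂ f (φ z) (φ 0 - φ z) +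
          s * (conj z * (T z - T 0 + conj (T 0) * z ^ 2)) := by
        simp only [smul_eq_mul, map_mul, Complex.conj_ofReal]
        ring
      rwa [e2, Complex.add_re, Complex.re_ofReal_mul] at h
    by_contra hne
    -- This `s` makes the left side of `key` equal to 1.
    have := key ((1 - (conj z * fderiv ℂ f (φ z) (φ 0 - φ z)).re) /
      (conj z * (T z - T 0 + conj (T 0) * z ^ 2)).re)
    rw [div_mul_cancel₀ _ hne] at this
    linarith
  set R : ℂ → ℂ := fun z => T z - T 0 + conj (T 0) * z ^ 2 with hR
  have hRd : DifferentiableOn ℂ R (Metric.ball 0 1) := by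
    rw [hR]; fun_prop
  have hR0 : R 0 = 0 := by simp [hR]
  have hball : Metric.ball (0 : ℂ) 1 ∈ 𝓝 0 := Metric.ball_mem_nhds _ one_pos
  have hGd : DifferentiableOn ℂ (dslope R 0) (Metric.ball 0 1) :=
    (Complex.differentiableOn_dslope hball).mpr hRd
  have hGre : ∀ z ∈ Metric.ball (0 : ℂ) 1, z ≠ 0 → (dslope R 0 z).re = 0 := by
    intro z hz hz0
    have h1 : R z = z * dslope R 0 z := by
      have := sub_smul_dslope R 0 z
      simpa [hR0] using this.symm
    have h2 := hQ z hz
    change (conj z * R z).re = 0 at h2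
    rw [h1, ← mul_assoc, mul_comm (conj z), Complex.mul_conj, Complex.re_ofReal_mul] at h2
    exact (mul_eq_zero.mp h2).resolve_left (by simpa using hz0)
  have hGre0 : (dslope R 0 0).re = 0 := by
    have h1 : Tendsto (fun z => (dslope R 0 z).re) (𝓝[≠] 0) (𝓝 (dslope R 0 0).re) :=
      ((Complex.continuous_re.continuousAt.comp (hGd.continuousOn.continuousAt hball)).tendsto).mono_left
        nhdsWithin_le_nhds
    refine tendsto_nhds_unique h1 (tendsto_const_nhds.congr' ?_)
    filter_upwards [self_mem_nhdsWithin, nhdsWithin_le_nhds hball] with z hz0 hz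
    exact (hGre z hz hz0).symm
  have hconst : ∀ z ∈ Metric.ball (0 : ℂ) 1, dslope R 0 z = dslope R 0 0 := by
    intro z hz
    refine eq_of_re_eq_zero hGd (fun w hw => ?_) hz
    by_cases hw0 : w = 0
    · rw [hw0, hGre0]
    · exact hGre w hw hw0
  -- By now `T z - T 0 + conj (T 0) * z ^ 2 = i β z` with `β` real. Since `T` is the derivative in
  -- direction `iY`, multiplying by `-i` returns to direction `Y` and makes the outer coefficients
  -- conjugate.
  refine ⟨-Complex.I * T 0, (dslope R 0 0).im, fun z hz => ?_⟩
  have h1 : R z = z * dslope R 0 z := by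
    have := sub_smul_dslope R 0 z
    simpa [hR0] using this.symm
  rw [hconst z hz] at h1
  have h2 : dslope R 0 0 = (dslope R 0 0).im * Complex.I := by
    have : ∀ w : ℂ, w.re = 0 → w = w.im * Complex.I := fun w hw => by
      apply Complex.ext <;> simp [hw]
    exact this _ hGre0
  have h3 : T z = Complex.I * fderiv ℂ f (φ z) v := by simp [hT]
  have h4 : fderiv ℂ f (φ z) v = -Complex.I * T z := by
    rw [h3, ← mul_assoc]; simp
  rw [h4, map_mul, map_neg, Complex.conj_I]
  rw [h2] at h1
  simp only [hR] at h1
  linear_combination (-Complex.I) * h1 - z * (dslope R 0 0).im * Complex.I_sq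

/-- The gradient of a holomorphic left inverse along the disc is a self-conjugate quadratic
polynomial. -/
theorem exists_quadratic_gradient {n : ℕ} {D : Set (Fin n → ℂ)} (hD : IsConvexTube D)
    {φ : ℂ → Fin n → ℂ} (hφ : IsHolomorphicDisc D φ) {f : (Fin n → ℂ) → ℂ}
    (hf : DifferentiableOn ℂ f D) (hb : ∀ x ∈ D, ‖f x‖ ≤ 1)
    (hfφ : ∀ z ∈ Metric.ball 0 1, f (φ z) = z) :
    ∃ (a : Fin n → ℂ) (b : Fin n → ℝ), ∀ z ∈ Metric.ball (0 : ℂ) 1, ∀ v,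
      fderiv ℂ f (φ z) v = (fun j => conj (a j) * z ^ 2 + (b j : ℂ) * z + a j) ⬝ᵥ v := by
  choose a b h using fun j : Fin n =>
    exists_quadratic_of_leftInverse hD hφ hf hb hfφ (Pi.single j 1)
  refine ⟨a, b, fun z hz v => ?_⟩
  have hv : v = ∑ j, v j • (Pi.single j 1 : Fin n → ℂ) := by
    ext i; simp [Finset.sum_apply, Pi.single_apply]
  conv_lhs => rw [hv]
  rw [map_sum]
  simp only [dotProduct, map_smul, smul_eq_mul]
  refine Finset.sum_congr rfl fun j _ => ?_
  rw [← h j z hz, mul_comm]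
  congr 2
  ext i
  by_cases hij : i = j
  · subst hij; simp
  · simp [hij]

/-! ### Necessity of the conditions -/

theorem ae_circleLebesgue_norm_eq_one : ∀ᵐ ζ ∂circleLebesgue, ‖ζ‖ = 1 := by
  rw [circleLebesgue, ae_map_iff (by fun_prop)
    (isClosed_eq continuous_norm continuous_const).measurableSet]
  exact Filter.Eventually.of_forall fun θ => by simp

theorem circleLebesgue_null_of_countable {s : Set ℂ} (hs : s.Countable) :
    circleLebesgue s = 0 := by
  rw [circleLebesgue, Measure.map_apply (by fun_prop) hs.measurableSet]
  exact Measure.absolutelyContinuous_of_le Measure.restrict_le_self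
    ((hs.preimage_circleMap 0 one_ne_zero).measure_zero _)

/-- Applied to one component of `h`, this confines the zeros of `h` on the circle to a null set, off
which strictness in (i) can be proved. -/
theorem finite_setOf_quadratic_eq_zero {a : ℂ} (ha : a ≠ 0) (b c : ℂ) :
    {z : ℂ | c * z ^ 2 + b * z + a = 0}.Finite := by
  set p : Polynomial ℂ := .C c * .X ^ 2 + .C b * .X + .C a with hp
  have hp0 : p ≠ 0 := by
    intro h
    apply ha
    have := congrArg (Polynomial.eval 0) h
    simpa [hp] using this
  refine (Polynomial.finite_setOfPred_isRoot hp0).subset fun z hz => ?_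
  simpa [hp, Polynomial.IsRoot] using hz

/-- The map `h` is the gradient of a holomorphic left inverse along `φ`. Both conditions come from
the variation inequality with a constant competitor: (i) from its boundary values, (ii) from the
competitor `φ 0`. -/
theorem IsComplexGeodesic.exists_quadratic {n : ℕ} {D : Set (Fin n → ℂ)} (hD : IsConvexTube D)
    {φ : ℂ → Fin n → ℂ} (hg : IsComplexGeodesic D φ)
    (hrad : ∀ᵐ ζ ∂circleLebesgue, ∃ w : Fin n → ℂ, HasRadialLimit φ ζ w) :
    ∃ h : ℂ → Fin n → ℂ,
      (∃ (a : Fin n → ℂ) (b : Fin n → ℝ), ∀ (z : ℂ) (j : Fin n),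
        h z j = conj (a j) * z ^ 2 + (b j : ℂ) * z + a j) ∧
      (∀ᵐ ζ ∂circleLebesgue, ∃ w : Fin n → ℂ, HasRadialLimit φ ζ w ∧
        ∀ z ∈ D, (conj ζ * (h ζ ⬝ᵥ (z - w))).re < 0) ∧
      (∀ z ∈ Metric.ball (0 : ℂ) 1, z ≠ 0 →
        (h z ⬝ᵥ (z⁻¹ • (φ 0 - φ z))).re < 0) := by
  have h0 := zero_mem_ball_zero_one
  have hφ := hg.1
  have hDo := hD.isOpen
  obtain ⟨f, hf, hb, hfφ⟩ := exists_holomorphic_leftInverse hDo hφ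
    (hg.2 0 h0 (1 / 2) (by norm_num))
  obtain ⟨a, b, hab⟩ := exists_quadratic_gradient hD hφ hf hb hfφ
  set h : ℂ → Fin n → ℂ := fun z j => conj (a j) * z ^ 2 + (b j : ℂ) * z + a j with hh
  change ∀ z ∈ Metric.ball (0 : ℂ) 1, ∀ v, fderiv ℂ f (φ z) v = h z ⬝ᵥ v at hab
  have hball : Metric.ball (0 : ℂ) 1 ∈ 𝓝 0 := Metric.ball_mem_nhds _ one_pos
  have hφ0 : HasDerivAt φ (deriv φ 0) 0 := (hφ.1.differentiableAt hball).hasDerivAt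
  have hgrad : h 0 ⬝ᵥ deriv φ 0 = 1 := by
    rw [← hab 0 h0]
    have h1 : HasDerivAt (fun z => f (φ z)) (fderiv ℂ f (φ 0) (deriv φ 0)) 0 :=
      ((hf.differentiableAt (hDo.mem_nhds (hφ.2 h0))).hasFDerivAt).comp_hasDerivAt 0 hφ0
    have h2 : HasDerivAt (fun z => f (φ z)) 1 0 :=
      (hasDerivAt_id 0).congr_of_eventuallyEq (by
        filter_upwards [hball] with z hz using hfφ z hz)
    exact h1.unique h2
  have hcont : Continuous h := by
    rw [hh]; fun_prop
  have hgen : ∀ x ∈ D, ∀ z ∈ Metric.ball (0 : ℂ) 1,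
      (conj z * (h z ⬝ᵥ (x - φ z) - h 0 ⬝ᵥ (x - φ 0) +
        conj (h 0 ⬝ᵥ (x - φ 0)) * z ^ 2)).re ≤ 0 := by
    intro x hx z hz
    have := re_conj_mul_variation_nonpos hDo hD.convex hf hb hφ.1 hφ.2
      (ψ := fun _ => x) (differentiableOn_const _) (fun _ _ => hx) hfφ hz
    rwa [hab z hz, hab 0 h0] at this
  refine ⟨h, ⟨a, b, fun _ _ => rfl⟩, ?_, ?_⟩
  · have hne : ∃ j, a j ≠ 0 := by
      by_contra! hall
      have : h 0 = 0 := by ext j; simp [hh, hall j]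
      simp [this] at hgrad
    obtain ⟨j, hj⟩ := hne
    have hnull : ∀ᵐ ζ ∂circleLebesgue, h ζ j ≠ 0 := by
      have := circleLebesgue_null_of_countable
        (finite_setOf_quadratic_eq_zero hj (b j) (conj (a j))).countable
      exact measure_eq_zero_iff_ae_notMem.mp this
    filter_upwards [hrad, ae_circleLebesgue_norm_eq_one, hnull] with ζ ⟨w, hw⟩ hζ hhζ
    refine ⟨w, hw, ?_⟩
    have hle : ∀ x ∈ D, (conj ζ * (h ζ ⬝ᵥ (x - w))).re ≤ 0 := by
      intro x hx
      set c := h 0 ⬝ᵥ (x - φ 0)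
      have hr : Tendsto (fun r : ℝ => (r : ℂ) * ζ) (𝓝[<] 1) (𝓝 ζ) := by
        have : ContinuousAt (fun r : ℝ => (r : ℂ) * ζ) 1 := by fun_prop
        simpa using this.tendsto.mono_left nhdsWithin_le_nhds
      have hcd : Continuous fun p : ℂ × (Fin n → ℂ) =>
          (conj p.1 * (h p.1 ⬝ᵥ (x - p.2) - c + conj c * p.1 ^ 2)).re := by
        simp only [dotProduct]
        fun_prop
      have hlim := (hcd.tendsto (ζ, w)).comp (hr.prodMk_nhds hw)
      have h1 : (conj ζ * (h ζ ⬝ᵥ (x - w) - c + conj c * ζ ^ 2)).re ≤ 0 := by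
        refine le_of_tendsto hlim ?_
        filter_upwards [Ioo_mem_nhdsLT (zero_lt_one (α := ℝ))] with r hr
        refine hgen x hx _ ?_
        rw [mem_ball_zero_iff, norm_mul, hζ, Complex.norm_real, Real.norm_of_nonneg hr.1.le,
          mul_one]
        exact hr.2
      have h2 : conj ζ * ζ = 1 := by
        rw [mul_comm, Complex.mul_conj', hζ]; simp
      -- On `|ζ| = 1` the terms in `c` combine to a number minus its conjugate, up to sign, and drop
      -- out of the real part.
      have h3 : (conj ζ * (h ζ ⬝ᵥ (x - w) - c + conj c * ζ ^ 2)) =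
          conj ζ * (h ζ ⬝ᵥ (x - w)) + (conj (conj ζ * c) - conj ζ * c) := by
        rw [map_mul, Complex.conj_conj]
        linear_combination conj c * ζ * h2
      rw [h3] at h1
      simpa using h1
    intro z hz
    refine lt_of_le_of_ne (hle z hz) fun heq => ?_
    -- In direction `u` the real part increases at rate `∑ |conj ζ * h ζ i|² > 0`. Equality at a
    -- point of the open set `D` would thus violate the weak inequality nearby.
    set u : Fin n → ℂ := fun i => conj (conj ζ * h ζ i)
    have hpath : Tendsto (fun t : ℝ => z + (t : ℂ) • u) (𝓝[>] 0) (𝓝 z) := by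
      have : ContinuousAt (fun t : ℝ => z + (t : ℂ) • u) 0 := by fun_prop
      simpa using this.tendsto.mono_left nhdsWithin_le_nhds
    obtain ⟨t, htD, ht⟩ := ((hpath.eventually (hDo.mem_nhds hz)).and
      (self_mem_nhdsWithin (s := Set.Ioi (0 : ℝ)))).exists
    have ht' : (0 : ℝ) < t := ht
    have h4 := hle _ htD
    have h5 : conj ζ * (h ζ ⬝ᵥ (z + (t : ℂ) • u - w)) = conj ζ * (h ζ ⬝ᵥ (z - w)) +
        ((t * ∑ i, ‖conj ζ * h ζ i‖ ^ 2 : ℝ) : ℂ) := by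
      have e1 : z + (t : ℂ) • u - w = (z - w) + (t : ℂ) • u := by abel
      rw [e1, dotProduct_add, mul_add, dotProduct_smul]
      congr 1
      simp only [dotProduct, smul_eq_mul, Complex.ofReal_mul, Complex.ofReal_sum,
        Complex.ofReal_pow, ← Complex.mul_conj', Finset.mul_sum]
      exact Finset.sum_congr rfl fun i _ => by simp only [u]; ring
    rw [h5, Complex.add_re, heq, Complex.ofReal_re, zero_add] at h4
    have h6 : 0 < ∑ i, ‖conj ζ * h ζ i‖ ^ 2 := by
      refine Finset.sum_pos' (fun i _ => by positivity) ⟨j, Finset.mem_univ _, ?_⟩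
      rw [norm_mul, RCLike.norm_conj, hζ, one_mul]
      have := norm_pos_iff.mpr hhζ
      positivity
    nlinarith
  · set V : ℂ → ℂ := fun z => h z ⬝ᵥ (φ 0 - φ z) with hV
    have hhd : ∀ z, DifferentiableAt ℂ h z := fun z => by rw [hh]; fun_prop
    have hV0 : V 0 = 0 := by simp [hV]
    have hVd : DifferentiableOn ℂ V (Metric.ball 0 1) := by
      have h1 := differentiableOn_pi.mp hφ.1
      have h2 : ∀ j, Differentiable ℂ fun z => h z j := fun j z =>
        (differentiableAt_pi.mp (hhd z)) j
      exact DifferentiableOn.fun_sum fun j _ =>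
        (h2 j).differentiableOn.mul ((h1 j).const_sub _)
    have hWd := (Complex.differentiableOn_dslope hball).mpr hVd
    have hVW : ∀ z, V z = z * dslope V 0 z := by
      intro z
      have := sub_smul_dslope V 0 z
      simpa [hV0] using this.symm
    -- The chain rule for `f ∘ φ = id` gives one point with strictly negative real part, and the
    -- strong maximum principle spreads it over the disc.
    have hW0 : dslope V 0 0 = -1 := by
      rw [dslope_same, ← hgrad]
      refine HasDerivAt.deriv ?_
      have h1 := hasDerivAt_pi.mp hφ0
      have h2 := hasDerivAt_pi.mp (hhd 0).hasDerivAt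
      have h3 : HasDerivAt V (∑ j, (deriv h 0 j * (φ 0 j - φ 0 j) + h 0 j * -(deriv φ 0 j))) 0 :=
        HasDerivAt.fun_sum fun j _ => (h2 j).mul ((h1 j).const_sub _)
      have h4 : ∑ j, (deriv h 0 j * (φ 0 j - φ 0 j) + h 0 j * -(deriv φ 0 j)) =
          -(h 0 ⬝ᵥ deriv φ 0) := by
        simp [dotProduct]
      rwa [h4] at h3
    have hWre : ∀ z ∈ Metric.ball (0 : ℂ) 1, (dslope V 0 z).re ≤ 0 := by
      intro z hz
      by_cases hz0 : z = 0
      · rw [hz0, hW0]; simp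
      · have h1 := hgen (φ 0) (hφ.2 h0) z hz
        simp only [sub_self, dotProduct_zero, sub_zero, map_zero, zero_mul, add_zero] at h1
        change (conj z * V z).re ≤ 0 at h1
        rw [hVW, ← mul_assoc, mul_comm (conj z), Complex.mul_conj, Complex.re_ofReal_mul] at h1
        have : 0 < Complex.normSq z := Complex.normSq_pos.mpr hz0
        by_contra! hc
        nlinarith [mul_pos this hc]
    intro z hz hz0
    have h1 := re_neg_of_re_nonpos hWd hWre h0 (by rw [hW0]; simp) hz
    rw [dotProduct_smul]
    change (z⁻¹ • V z).re < 0
    rwa [hVW, smul_eq_mul, inv_mul_cancel_left₀ hz0]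

/-! ### Angular parameter and Fatou's theorem -/

/-- A property of points of the circle holds almost everywhere iff it does so in the angular
parameter. -/
theorem ae_circleLebesgue_iff {p : ℂ → Prop} :
    (∀ᵐ ζ ∂circleLebesgue, p ζ) ↔ ∀ᵐ θ : ℝ, p (circleMap 0 1 θ) := by
  constructor
  · intro h
    have h1 : ∀ᵐ θ ∂volume.restrict (Set.Ioc (-Real.pi) Real.pi), p (circleMap 0 1 θ) :=
      ae_of_ae_map (by fun_prop) h
    have hfd := isAddFundamentalDomain_Ioc Real.two_pi_pos (-Real.pi)
    refine hfd.measure_zero_of_invariant _ (fun g => ?_) ?_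
    · obtain ⟨_, k, rfl⟩ := g
      have hper := (periodic_circleMap 0 1).zsmul k
      ext θ
      rw [Set.mem_vadd_set_iff_neg_vadd_mem]
      have : circleMap 0 1 (-(k • (2 * Real.pi)) + θ) = circleMap 0 1 θ := by
        rw [neg_add_eq_sub, hper.sub_eq]
      change ¬ p (circleMap 0 1 (-(k • (2 * Real.pi)) + θ)) ↔ ¬ p (circleMap 0 1 θ)
      rw [this]
    · have e : -Real.pi + 2 * Real.pi = Real.pi := by ring
      rw [e, ← Measure.restrict_apply' measurableSet_Ioc]
      exact h1
  · intro h
    -- The property `p` need not be measurable. The exceptional set is enlarged to a measurable null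
    -- set, whose injective image on one period is measurable.
    set N' := toMeasurable volume {θ : ℝ | ¬ p (circleMap 0 1 θ)}
    have hN' : volume N' = 0 := by rw [measure_toMeasurable]; exact h
    have hinj : Set.InjOn (circleMap 0 1) (Set.Ioc (-Real.pi) Real.pi) := by
      have := injOn_circleMap_of_abs_sub_le (a := -Real.pi) (b := Real.pi) (R := 1) (c := 0)
        one_ne_zero (by rw [abs_of_nonpos] <;> linarith [Real.pi_pos])
      rwa [Set.uIoc_of_le (by linarith [Real.pi_pos])] at this
    set S := circleMap 0 1 '' (Set.Ioc (-Real.pi) Real.pi ∩ N')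
    have hSm : MeasurableSet S :=
      (measurableSet_Ioc.inter (measurableSet_toMeasurable _ _)).image_of_measurable_injOn
        (by fun_prop) (hinj.mono Set.inter_subset_left)
    have hS : circleLebesgue S = 0 := by
      rw [circleLebesgue, Measure.map_apply (by fun_prop) hSm,
        Measure.restrict_apply' measurableSet_Ioc]
      refine measure_mono_null ?_ hN'
      rintro θ ⟨⟨θ', ⟨hθ', hN⟩, he⟩, hθ⟩
      rwa [← hinj hθ' hθ he]
    filter_upwards [ae_circleLebesgue_norm_eq_one, measure_eq_zero_iff_ae_notMem.mp hS] with ζ hζ hζS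
    by_contra hp
    have he : circleMap 0 1 ζ.arg = ζ := by
      have := Complex.norm_mul_exp_arg_mul_I ζ
      rw [circleMap_zero, ← hζ, this]
    refine hζS ⟨ζ.arg, ⟨Complex.arg_mem_Ioc ζ, subset_toMeasurable _ _ ?_⟩, he⟩
    change ¬ p (circleMap 0 1 ζ.arg)
    rwa [he]

/-- The mean value property on the unit circle for bounded holomorphic functions with radial
limits. -/
theorem eq_integral_of_tendsto_radial {P : ℂ → ℂ} {C : ℝ}
    (hP : DifferentiableOn ℂ P (Metric.ball 0 1)) (hC : ∀ z ∈ Metric.ball (0 : ℂ) 1, ‖P z‖ ≤ C)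
    {p : ℝ → ℂ}
    (hp : ∀ᵐ θ : ℝ, Tendsto (fun r : ℝ => P (r * circleMap 0 1 θ)) (𝓝[<] 1) (𝓝 (p θ))) :
    P 0 = (2 * Real.pi)⁻¹ • ∫ θ in 0..2 * Real.pi, p θ := by
  have hin : ∀ r ∈ Set.Ioo (0 : ℝ) 1, ∀ θ : ℝ, (r * circleMap 0 1 θ : ℂ) ∈ Metric.ball (0 : ℂ) 1 := by
    intro r hr θ
    simpa [abs_of_pos hr.1] using hr.2
  have hmem : ∀ᶠ r : ℝ in 𝓝[<] 1, r ∈ Set.Ioo (0 : ℝ) 1 := Ioo_mem_nhdsLT zero_lt_one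
  have h1 : Tendsto (fun r : ℝ => ∫ θ in 0..2 * Real.pi, P (r * circleMap 0 1 θ)) (𝓝[<] 1)
      (𝓝 (∫ θ in 0..2 * Real.pi, p θ)) := by
    refine intervalIntegral.tendsto_integral_filter_of_dominated_convergence (fun _ => C) ?_ ?_
      intervalIntegrable_const ?_
    · filter_upwards [hmem] with r hr
      have : Continuous fun θ : ℝ => P (r * circleMap 0 1 θ) :=
        hP.continuousOn.comp_continuous (by fun_prop) (hin r hr)
      exact this.aestronglyMeasurable
    · filter_upwards [hmem] with r hr
      exact Filter.Eventually.of_forall fun θ _ => hC _ (hin r hr θ)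
    · filter_upwards [hp] with θ hθ _ using hθ
  have h2 := h1.const_smul (2 * Real.pi)⁻¹
  refine tendsto_nhds_unique (tendsto_const_nhds.congr' ?_) h2
  filter_upwards [hmem] with r hr
  have hd : DiffContOnCl ℂ P (Metric.ball 0 |r|) :=
    (hP.mono (by
      rw [abs_of_pos hr.1]; exact Metric.closedBall_subset_ball hr.2)).diffContOnCl_ball subset_rfl
  have := hd.circleAverage
  rw [Real.circleAverage_def] at this
  rw [← this]
  congr 1
  refine intervalIntegral.integral_congr fun θ _ => ?_
  simp [circleMap]

theorem norm_discMoebius_eq_one {a z : ℂ} (ha : ‖a‖ < 1) (hz : ‖z‖ = 1) :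
    ‖discMoebius a z‖ = 1 := by
  have h0 := one_sub_conj_mul_ne_zero ha hz.le
  rw [discMoebius, norm_div, div_eq_one_iff_eq (norm_ne_zero_iff.mpr h0)]
  have h := sq_norm_one_sub_conj_mul_sub a z
  rw [hz] at h
  exact (pow_left_inj₀ (norm_nonneg _) (norm_nonneg _) two_ne_zero).mp (by linarith)

theorem continuousAt_discMoebius {a z : ℂ} (ha : ‖a‖ < 1) (hz : ‖z‖ ≤ 1) :
    ContinuousAt (discMoebius a) z := by
  unfold discMoebius
  exact ContinuousAt.div (by fun_prop) (by fun_prop) (one_sub_conj_mul_ne_zero ha hz)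

theorem discMoebius_neg_ofReal_ne_one {r : ℝ} (hr : r ∈ Set.Ioo (0 : ℝ) 1) {z : ℂ} (hz : ‖z‖ ≤ 1)
    (h1 : z ≠ 1) : discMoebius (-r) z ≠ 1 := by
  have hr' : ‖(-r : ℂ)‖ < 1 := by simpa [abs_of_pos hr.1] using hr.2
  rw [discMoebius, Ne, div_eq_one_iff_eq (one_sub_conj_mul_ne_zero hr' hz)]
  simp only [map_neg, Complex.conj_ofReal]
  intro h
  have h2 : (z - 1) * (1 - r) = 0 := by linear_combination h
  rcases mul_eq_zero.mp h2 with h3 | h3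
  · exact h1 (sub_eq_zero.mp h3)
  · have : (1 : ℝ) - r = 0 := by exact_mod_cast h3
    linarith [hr.2]

/-- If a bounded holomorphic function on the disc extends continuously to the circle except at `1`
and its boundary values tend to `0` at `1`, then so do the function and its invariant derivative
along the radius to `1`. -/
theorem tendsto_radius_of_tendsto_circle {Q : ℂ → ℂ} {C : ℝ} (hQm : Measurable Q)
    (hQd : DifferentiableOn ℂ Q (Metric.ball 0 1)) (hQC : ∀ z, ‖Q z‖ ≤ C)
    (hQc : ∀ z ≠ 1, ContinuousAt Q z)
    (hQ0 : Tendsto Q (𝓝[Metric.sphere 0 1 \ {1}] 1) (𝓝 0)) :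
    Tendsto (fun r : ℝ => Q r) (𝓝[<] 1) (𝓝 0) ∧
      Tendsto (fun r : ℝ => deriv Q r * (1 - r ^ 2)) (𝓝[<] 1) (𝓝 0) := by
  have hmem : ∀ᶠ r : ℝ in 𝓝[<] 1, r ∈ Set.Ioo (0 : ℝ) 1 := Ioo_mem_nhdsLT zero_lt_one
  have hnorm : ∀ r ∈ Set.Ioo (0 : ℝ) 1, ‖(-r : ℂ)‖ < 1 := fun r hr => by
    simpa [abs_of_pos hr.1] using hr.2
  -- The transformation `(z + r) / (1 + r z)` sends `0` to `r` and, as `r → 1`, pushes every point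
  -- of the circle except `-1` to `1`. The mean value formula in this parametrization and dominated
  -- convergence give the limits.
  set p : ℝ → ℝ → ℂ := fun r θ => Q (discMoebius (-r) (circleMap 0 1 θ)) with hp
  have hball : Metric.ball (0 : ℂ) 1 ∈ 𝓝 0 := Metric.ball_mem_nhds _ one_pos
  have hae : ∀ᵐ θ : ℝ, circleMap 0 1 θ ≠ 1 ∧ circleMap 0 1 θ ≠ -1 := by
    have h1 : ∀ w : ℂ, ∀ᵐ θ : ℝ, circleMap 0 1 θ ≠ w := fun w =>
      measure_eq_zero_iff_ae_notMem.mp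
        (((Set.countable_singleton w).preimage_circleMap 0 one_ne_zero).measure_zero volume)
    exact (h1 1).and (h1 (-1))
  have hrad : ∀ r ∈ Set.Ioo (0 : ℝ) 1, ∀ᵐ θ : ℝ,
      Tendsto (fun s : ℝ => Q (discMoebius (-r) (s * circleMap 0 1 θ))) (𝓝[<] 1) (𝓝 (p r θ)) := by
    intro r hr
    filter_upwards [hae] with θ ⟨hθ, _⟩
    have h1 : Tendsto (fun s : ℝ => (s * circleMap 0 1 θ : ℂ)) (𝓝[<] 1) (𝓝 (circleMap 0 1 θ)) := by
      have : ContinuousAt (fun s : ℝ => (s * circleMap 0 1 θ : ℂ)) 1 := by fun_prop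
      simpa using this.tendsto.mono_left nhdsWithin_le_nhds
    have h2 : ‖circleMap 0 1 θ‖ ≤ 1 := by simp
    exact ((hQc _ (discMoebius_neg_ofReal_ne_one hr h2 hθ)).tendsto.comp
      (continuousAt_discMoebius (hnorm r hr) h2).tendsto).comp h1
  have hlim : ∀ᵐ θ : ℝ, Tendsto (fun r => p r θ) (𝓝[<] 1) (𝓝 0) := by
    filter_upwards [hae] with θ ⟨hθ1, hθ2⟩
    refine hQ0.comp (tendsto_nhdsWithin_iff.mpr ⟨?_, ?_⟩)
    · have h3 : 1 + circleMap 0 1 θ ≠ 0 := fun h => hθ2 (by linear_combination h)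
      have : ContinuousAt (fun r : ℝ => discMoebius (-r) (circleMap 0 1 θ)) 1 := by
        unfold discMoebius
        refine ContinuousAt.div (by fun_prop) ?_ (by simpa using h3)
        simp only [map_neg, Complex.conj_ofReal]
        fun_prop
      have h4 : discMoebius (-(1 : ℝ)) (circleMap 0 1 θ) = 1 := by
        rw [discMoebius]
        simp only [Complex.ofReal_one, sub_neg_eq_add, map_neg, map_one, neg_mul, one_mul]
        rw [add_comm, div_self h3]
      have h5 := this.tendsto.mono_left (nhdsWithin_le_nhds (s := Set.Iio 1))
      rwa [h4] at h5
    · filter_upwards [hmem] with r hr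
      refine ⟨?_, discMoebius_neg_ofReal_ne_one hr (by simp) hθ1⟩
      rw [mem_sphere_zero_iff_norm]
      exact norm_discMoebius_eq_one (hnorm r hr) (by simp)
  have hpm : ∀ r, Measurable (p r) := fun r => by
    have : Measurable (discMoebius (-r)) := by unfold discMoebius; fun_prop
    exact hQm.comp (this.comp (by fun_prop))
  have hPd : ∀ r ∈ Set.Ioo (0 : ℝ) 1,
      DifferentiableOn ℂ (fun z => Q (discMoebius (-r) z)) (Metric.ball 0 1) := fun r hr =>
    hQd.comp (differentiableOn_discMoebius (hnorm r hr)) (mapsTo_discMoebius (hnorm r hr))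
  have hm0 : ∀ r : ℝ, discMoebius (-r) 0 = r := fun r => by simp [discMoebius]
  have hQr : Tendsto (fun r : ℝ => Q r) (𝓝[<] 1) (𝓝 0) := by
    have h1 : Tendsto (fun r => (2 * Real.pi)⁻¹ • ∫ θ in 0..2 * Real.pi, p r θ) (𝓝[<] 1)
        (𝓝 ((2 * Real.pi)⁻¹ • ∫ _θ in 0..2 * Real.pi, (0 : ℂ))) := by
      refine Tendsto.const_smul (intervalIntegral.tendsto_integral_filter_of_dominated_convergence
        (fun _ => C) (Filter.Eventually.of_forall fun r => (hpm r).aestronglyMeasurable)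
        (Filter.Eventually.of_forall fun r => Filter.Eventually.of_forall fun θ _ => hQC _)
        intervalIntegrable_const ?_) _
      filter_upwards [hlim] with θ hθ _ using hθ
    simp only [intervalIntegral.integral_zero, smul_zero] at h1
    refine h1.congr' ?_
    filter_upwards [hmem] with r hr
    rw [← eq_integral_of_tendsto_radial (hPd r hr) (fun z _ => hQC _) (hrad r hr), hm0]
  refine ⟨hQr, ?_⟩
  have h1 : Tendsto (fun r => (2 * Real.pi)⁻¹ •
      ∫ θ in 0..2 * Real.pi, (p r θ - Q r) / circleMap 0 1 θ) (𝓝[<] 1)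
      (𝓝 ((2 * Real.pi)⁻¹ • ∫ _θ in 0..2 * Real.pi, (0 : ℂ))) := by
    refine Tendsto.const_smul (intervalIntegral.tendsto_integral_filter_of_dominated_convergence
      (fun _ => C + C) (Filter.Eventually.of_forall fun r =>
        (((hpm r).sub_const _).div (by fun_prop)).aestronglyMeasurable)
      (Filter.Eventually.of_forall fun r => Filter.Eventually.of_forall fun θ _ => ?_)
      intervalIntegrable_const ?_) _
    · rw [Pi.div_apply, norm_div, norm_circleMap_zero, abs_one, div_one]
      exact (norm_sub_le _ _).trans (add_le_add (hQC _) (hQC _))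
    · filter_upwards [hlim] with θ hθ _
      simpa using (hθ.sub hQr).div_const (circleMap 0 1 θ)
  simp only [intervalIntegral.integral_zero, smul_zero] at h1
  refine h1.congr' ?_
  filter_upwards [hmem] with r hr
  -- The slope function at 0 of the reparametrized `Q` takes the value `deriv Q r * (1 - r ^ 2)` at
  -- 0, and that value is the mean of its boundary values.
  have h2 := eq_integral_of_tendsto_radial
    (P := dslope (fun z => Q (discMoebius (-r) z)) 0) (C := C + C)
    (p := fun θ => (p r θ - Q r) / circleMap 0 1 θ)
    ((Complex.differentiableOn_dslope hball).mpr (hPd r hr)) (fun z hz => by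
      have := Complex.norm_dslope_le_div_of_mapsTo_ball (R₂ := C + C) (hPd r hr) (fun y hy => by
        rw [Metric.mem_closedBall, dist_eq_norm]
        exact (norm_sub_le _ _).trans (add_le_add (hQC _) (hQC _))) hz
      simpa using this) (by
      filter_upwards [hrad r hr] with θ hθ
      have hs : Tendsto (fun s : ℝ => (s * circleMap 0 1 θ : ℂ)) (𝓝[<] 1)
          (𝓝 (circleMap 0 1 θ)) := by
        have : ContinuousAt (fun s : ℝ => (s * circleMap 0 1 θ : ℂ)) 1 := by fun_prop
        simpa using this.tendsto.mono_left nhdsWithin_le_nhds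
      have hc : circleMap 0 1 θ ≠ 0 := circleMap_ne_center one_ne_zero
      refine ((hθ.sub_const (Q r)).div hs hc).congr' ?_
      filter_upwards [hmem] with s hs
      have : (s * circleMap 0 1 θ : ℂ) ≠ 0 := mul_ne_zero (by exact_mod_cast hs.1.ne') hc
      rw [dslope_of_ne _ this, slope_def_field, hm0, sub_zero]
      rfl)
  rw [← h2, dslope_same]
  have hr1 : (r : ℂ) ∈ Metric.ball (0 : ℂ) 1 := by simpa [abs_of_pos hr.1] using hr.2
  have hmd : HasDerivAt (discMoebius (-r)) (1 - r ^ 2 : ℂ) 0 := by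
    have h3 : HasDerivAt (fun z : ℂ => z - -(r : ℂ)) 1 0 := (hasDerivAt_id 0).sub_const _
    have h4 : HasDerivAt (fun z : ℂ => 1 - conj (-(r : ℂ)) * z) (-(conj (-(r : ℂ)) * 1)) 0 :=
      ((hasDerivAt_id (0 : ℂ)).const_mul _).const_sub _
    have h5 := h3.div h4 (by simp)
    refine h5.congr_deriv ?_
    simp
    ring
  have hQr' : HasDerivAt Q (deriv Q r) (discMoebius (-r) 0) := by
    rw [hm0]
    exact (hQd.differentiableAt (Metric.isOpen_ball.mem_nhds hr1)).hasDerivAt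
  exact (hQr'.comp 0 hmd).deriv

/-- If a Lipschitz primitive of a holomorphic function on the disc is differentiable along the
circle at `1`, then the function has a radial limit at `1`. -/
theorem tendsto_radius_of_hasDerivAt_circle {G B : ℂ → ℂ} {K : NNReal} (hG : LipschitzWith K G)
    (hGB : ∀ z ∈ Metric.ball (0 : ℂ) 1, HasDerivAt G (B z) z) {A : ℂ}
    (hA : HasDerivAt (fun θ : ℝ => G (circleMap 0 1 θ)) A 0) :
    Tendsto (fun r : ℝ => B r) (𝓝[<] 1) (𝓝 (A / Complex.I)) := by
  -- The difference quotient of `G` at `1`, recentred to tend to 0 along the circle. Since `G z = G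
  -- 1 + (Q z + A/i) (z - 1)`, one has `B r = A/i + Q r - deriv Q r * (1 - r)`.
  set Q : ℂ → ℂ := fun z => (G z - G 1) / (z - 1) - A / Complex.I with hQ
  have hGc := hG.continuous
  have hne : ∀ z ∈ Metric.ball (0 : ℂ) 1, z - 1 ≠ 0 := by
    intro z hz h
    rw [sub_eq_zero.mp h] at hz
    simp at hz
  have hQd : ∀ z ∈ Metric.ball (0 : ℂ) 1, DifferentiableAt ℂ Q z := fun z hz =>
    (((hGB z hz).differentiableAt.sub_const _).div (by fun_prop) (hne z hz)).sub_const _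
  have hc1 : circleMap 0 1 0 = 1 := by simp [circleMap]
  have hcd : HasDerivAt (circleMap 0 1) Complex.I 0 := by
    simpa [hc1] using hasDerivAt_circleMap 0 1 0
  have hQθ : Tendsto (fun θ : ℝ => Q (circleMap 0 1 θ)) (𝓝[≠] 0) (𝓝 0) := by
    have h1 := (hasDerivAt_iff_tendsto_slope_zero.mp hA).div
      (hasDerivAt_iff_tendsto_slope_zero.mp hcd) Complex.I_ne_zero
    have h2 := h1.sub_const (A / Complex.I)
    rw [sub_self] at h2
    refine h2.congr' ?_
    filter_upwards [self_mem_nhdsWithin] with t ht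
    have ht' : (t⁻¹ : ℂ) ≠ 0 := inv_ne_zero (by exact_mod_cast ht)
    simp only [hQ, zero_add, hc1, Complex.real_smul, Complex.ofReal_inv, Pi.div_apply]
    rw [mul_div_mul_left _ _ ht']
  have hQ0 : Tendsto Q (𝓝[Metric.sphere 0 1 \ {1}] 1) (𝓝 0) := by
    have harg : Tendsto Complex.arg (𝓝[Metric.sphere 0 1 \ {1}] 1) (𝓝[≠] 0) := by
      refine tendsto_nhdsWithin_iff.mpr ⟨?_, ?_⟩
      · have := (Complex.continuousAt_arg Complex.one_mem_slitPlane).tendsto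
        rw [Complex.arg_one] at this
        exact this.mono_left nhdsWithin_le_nhds
      · filter_upwards [self_mem_nhdsWithin] with z ⟨hz, hz1⟩ h0
        have := Complex.norm_mul_exp_arg_mul_I z
        rw [mem_sphere_zero_iff_norm.mp hz, h0] at this
        exact hz1 (by simpa using this.symm)
    refine (hQθ.comp harg).congr' ?_
    filter_upwards [self_mem_nhdsWithin] with z ⟨hz, _⟩
    have := Complex.norm_mul_exp_arg_mul_I z
    rw [mem_sphere_zero_iff_norm.mp hz] at this
    simp only [Function.comp, circleMap_zero, this]
  obtain ⟨hl1, hl2⟩ := tendsto_radius_of_tendsto_circle (Q := Q) (C := K + ‖A / Complex.I‖)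
    (by fun_prop) (fun z hz => (hQd z hz).differentiableWithinAt) (fun z => by
      refine (norm_sub_le _ _).trans (add_le_add_left ?_ _)
      rw [norm_div]
      refine div_le_of_le_mul₀ (norm_nonneg _) K.2 ?_
      simpa [dist_eq_norm] using hG.dist_le_mul z 1) (fun z hz => by
      have h1 : ContinuousAt (fun z => (G z - G 1) / (z - 1)) z :=
        ContinuousAt.div (by fun_prop) (by fun_prop) (sub_ne_zero.mpr hz)
      exact h1.sub_const _) hQ0
  have h3 : Tendsto (fun r : ℝ => A / Complex.I + Q r - deriv Q r * (1 - r ^ 2) / (1 + r)) (𝓝[<] 1)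
      (𝓝 (A / Complex.I + 0 - 0 / (1 + 1))) := by
    have h4 : Tendsto (fun r : ℝ => (1 + r : ℂ)) (𝓝[<] 1) (𝓝 (1 + 1)) := by
      have : ContinuousAt (fun r : ℝ => (1 + r : ℂ)) 1 := by fun_prop
      simpa using this.tendsto.mono_left nhdsWithin_le_nhds
    exact (hl1.const_add _).sub (hl2.div h4 (by norm_num))
  simp only [zero_div, sub_zero, add_zero] at h3
  refine h3.congr' ?_
  filter_upwards [Ioo_mem_nhdsLT (zero_lt_one (α := ℝ))] with r hr
  have hr1 : (r : ℂ) ∈ Metric.ball (0 : ℂ) 1 := by simpa [abs_of_pos hr.1] using hr.2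
  have h5 : HasDerivAt (fun z => G 1 + (Q z + A / Complex.I) * (z - 1))
      (deriv Q r * (r - 1) + (Q r + A / Complex.I) * 1) r :=
    ((((hQd r hr1).hasDerivAt.add_const _).mul ((hasDerivAt_id (r : ℂ)).sub_const 1))).const_add _
  have h6 : (fun z => G 1 + (Q z + A / Complex.I) * (z - 1)) =ᶠ[𝓝 (r : ℂ)] G := by
    filter_upwards [Metric.isOpen_ball.mem_nhds hr1] with z hz
    simp only [hQ, sub_add_cancel, div_mul_cancel₀ _ (hne z hz), add_sub_cancel]
  have h7 := (hGB r hr1).unique (h5.congr_of_eventuallyEq h6.symm)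
  have h8 : (1 + r : ℂ) ≠ 0 := by
    have : (0 : ℝ) < 1 + r := by linarith [hr.1]
    exact_mod_cast this.ne'
  have h9 : deriv Q r * (1 - (r : ℂ) ^ 2) / (1 + r) = deriv Q r * (1 - r) := by
    rw [div_eq_iff h8]; ring
  rw [h7, h9]
  ring

/-- **Fatou's theorem**: a bounded holomorphic function on the disc has radial limits almost
everywhere. -/
theorem ae_exists_radial_limit_of_bounded {B : ℂ → ℂ} {M : ℝ}
    (hB : DifferentiableOn ℂ B (Metric.ball 0 1)) (hM : ∀ z ∈ Metric.ball (0 : ℂ) 1, ‖B z‖ ≤ M) :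
    ∀ᵐ θ : ℝ, ∃ w, Tendsto (fun r : ℝ => B (r * circleMap 0 1 θ)) (𝓝[<] 1) (𝓝 w) := by
  obtain ⟨F, hF⟩ := hB.isExactOn_ball
  have hFl : LipschitzOnWith M.toNNReal F (Metric.ball 0 1) :=
    (convex_ball (0 : ℂ) 1).lipschitzOnWith_of_nnnorm_hasDerivWithin_le
      (fun z hz => (hF z hz).hasDerivWithinAt) fun z hz => by
        rw [← NNReal.coe_le_coe, coe_nnnorm]
        exact (hM z hz).trans (Real.le_coe_toNNReal M)
  obtain ⟨G, hG, hFG⟩ := hFl.extend_finite_dimension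
  have hGB : ∀ z ∈ Metric.ball (0 : ℂ) 1, HasDerivAt G (B z) z := fun z hz =>
    (hF z hz).congr_of_eventuallyEq
      (hFG.symm.eventuallyEq_of_mem (Metric.isOpen_ball.mem_nhds hz))
  -- A Lipschitz function of the angle is differentiable almost everywhere. A rotation moves each
  -- such point to `1`.
  filter_upwards [(hG.comp (lipschitzWith_circleMap 0 1)).ae_differentiableAt_real] with θ hθ
  set ζ := circleMap 0 1 θ
  have hζ : ‖ζ‖ = 1 := by simp [ζ]
  have hrot : LipschitzWith 1 (fun z : ℂ => ζ * z) := by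
    refine LipschitzWith.of_dist_le_mul fun x y => ?_
    rw [dist_eq_norm, dist_eq_norm, ← mul_sub, norm_mul, hζ]
    simp
  have h1 := tendsto_radius_of_hasDerivAt_circle (G := fun z => G (ζ * z))
    (B := fun z => B (ζ * z) * ζ) (hG.comp hrot) (fun z hz => by
      have hz' : ζ * z ∈ Metric.ball (0 : ℂ) 1 := by simpa [hζ] using hz
      have h2 : HasDerivAt (fun z => ζ * z) ζ z := by
        simpa using (hasDerivAt_id z).const_mul ζ
      exact (hGB _ hz').comp z h2)
    (A := deriv (G ∘ circleMap 0 1) θ) (by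
      have h2 : HasDerivAt (G ∘ circleMap 0 1) (deriv (G ∘ circleMap 0 1) θ) (θ + 0) := by
        simpa using hθ.hasDerivAt
      have h3 := h2.comp_const_add θ 0
      refine h3.congr_of_eventuallyEq (Filter.Eventually.of_forall fun t => ?_)
      simp [ζ, circleMap_zero_mul])
  refine ⟨_, (h1.div_const ζ).congr fun r => ?_⟩
  rw [mul_div_cancel_right₀ _ (circleMap_ne_center one_ne_zero), mul_comm]

/-! ### Poisson integrals and functions with values in a half-plane -/

theorem poissonKernel_circleMap_pos {w : ℂ} (hw : ‖w‖ < 1) (θ : ℝ) :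
    0 < poissonKernel 0 w (circleMap 0 1 θ) := by
  rw [poissonKernel_def]
  simp only [sub_zero, norm_circleMap_zero, abs_one]
  have h1 : circleMap 0 1 θ - w ≠ 0 :=
    sub_ne_zero.mpr (circleMap_ne_mem_ball (mem_ball_zero_iff.mpr hw) θ)
  have h2 := norm_pos_iff.mpr h1
  refine div_pos ?_ (by positivity)
  nlinarith [norm_nonneg w]

theorem continuous_poissonKernel_circleMap {w : ℂ} (hw : ‖w‖ < 1) :
    Continuous fun θ : ℝ => poissonKernel 0 w (circleMap 0 1 θ) := by
  simp only [poissonKernel_def, sub_zero]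
  refine Continuous.div (by fun_prop) (by fun_prop) fun θ => ?_
  have h1 : circleMap 0 1 θ - w ≠ 0 :=
    sub_ne_zero.mpr (circleMap_ne_mem_ball (mem_ball_zero_iff.mpr hw) θ)
  simpa using h1

/-- The Poisson formula for nonnegative real parts, in terms of the lower integral. -/
theorem lintegral_poissonKernel_mul_re {g : ℂ → ℂ}
    (hg : DifferentiableOn ℂ g (Metric.closedBall 0 1)) (h0 : ∀ z, ‖z‖ = 1 → 0 ≤ (g z).re)
    {w : ℂ} (hw : ‖w‖ < 1) :
    ∫⁻ θ in Set.Ioc 0 (2 * Real.pi), ENNReal.ofReal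
      (poissonKernel 0 w (circleMap 0 1 θ) * (g (circleMap 0 1 θ)).re) =
      ENNReal.ofReal (2 * Real.pi * (g w).re) := by
  have hPc := continuous_poissonKernel_circleMap hw
  have hgc : Continuous fun θ : ℝ => g (circleMap 0 1 θ) :=
    hg.continuousOn.comp_continuous (by fun_prop) fun θ => by simp
  have h1 := (hg.diffContOnCl_ball subset_rfl).circleAverage_poissonKernel_smul
    (mem_ball_zero_iff.mpr hw)
  rw [Real.circleAverage_def, inv_smul_eq_iff₀ Real.two_pi_pos.ne',
    intervalIntegral.integral_of_le Real.two_pi_pos.le] at h1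
  have hI : Integrable (fun θ : ℝ => poissonKernel 0 w (circleMap 0 1 θ) •
      g (circleMap 0 1 θ)) (volume.restrict (Set.Ioc 0 (2 * Real.pi))) :=
    ((hPc.smul hgc).integrableOn_Icc).mono_set Set.Ioc_subset_Icc_self
  have h2 := congrArg Complex.re h1
  simp only [Pi.smul_apply', Complex.real_smul, Complex.re_ofReal_mul] at h2
  rw [← h2]
  have h3 := Complex.reCLM.integral_comp_comm hI
  simp only [Complex.reCLM_apply, Complex.real_smul, Complex.re_ofReal_mul] at h3
  have hI' : Integrable (fun θ : ℝ => poissonKernel 0 w (circleMap 0 1 θ) *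
      (g (circleMap 0 1 θ)).re) (volume.restrict (Set.Ioc 0 (2 * Real.pi))) := by
    simpa using hI.re
  rw [← h3, ofReal_integral_eq_lintegral_ofReal hI']
  exact Filter.Eventually.of_forall fun θ =>
    mul_nonneg (poissonKernel_circleMap_pos hw θ).le (h0 _ (by simp))

/-- Fatou's lemma for the Poisson integrals of a holomorphic function with nonnegative real
part. -/
theorem lintegral_liminf_poissonKernel_mul_re_le {g : ℂ → ℂ}
    (hg : DifferentiableOn ℂ g (Metric.ball 0 1))
    (h0 : ∀ z ∈ Metric.ball (0 : ℂ) 1, 0 ≤ (g z).re) {w : ℂ} (hw : ‖w‖ < 1) {s : ℕ → ℝ}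
    (hs : ∀ k, s k ∈ Set.Ioo (0 : ℝ) 1) (hs1 : Tendsto s atTop (𝓝 1)) :
    ∫⁻ θ in Set.Ioc 0 (2 * Real.pi), liminf (fun k => ENNReal.ofReal
      (poissonKernel 0 w (circleMap 0 1 θ) * (g (s k * circleMap 0 1 θ)).re)) atTop ≤
      ENNReal.ofReal (2 * Real.pi * (g w).re) := by
  have hin : ∀ k, ∀ z : ℂ, ‖z‖ ≤ 1 → (s k * z : ℂ) ∈ Metric.ball (0 : ℂ) 1 := by
    intro k z hz
    rw [mem_ball_zero_iff, norm_mul, Complex.norm_real, Real.norm_of_nonneg (hs k).1.le]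
    nlinarith [(hs k).1, (hs k).2]
  have hint : ∀ k, ∫⁻ θ in Set.Ioc 0 (2 * Real.pi), ENNReal.ofReal
      (poissonKernel 0 w (circleMap 0 1 θ) * (g (s k * circleMap 0 1 θ)).re) =
      ENNReal.ofReal (2 * Real.pi * (g (s k * w)).re) := fun k =>
    lintegral_poissonKernel_mul_re (g := fun z => g (s k * z))
      (hg.comp (by fun_prop) fun z hz => hin k z (mem_closedBall_zero_iff.mp hz))
      (fun z hz => h0 _ (hin k z hz.le)) hw
  refine (lintegral_liminf_le fun k => ?_).trans ?_
  · have hgc : Continuous fun θ : ℝ => g (s k * circleMap 0 1 θ) :=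
      hg.continuousOn.comp_continuous (by fun_prop) fun θ => hin k _ (by simp)
    exact ((continuous_poissonKernel_circleMap hw).mul
      (Complex.continuous_re.comp hgc)).measurable.ennreal_ofReal
  · simp only [hint]
    refine le_of_eq (Tendsto.liminf_eq ?_)
    refine (ENNReal.continuous_ofReal.tendsto _).comp (Tendsto.const_mul _ ?_)
    refine (Complex.continuous_re.tendsto _).comp ?_
    have h1 : Tendsto (fun k => (s k : ℂ) * w) atTop (𝓝 w) := by
      have := ((Complex.continuous_ofReal.tendsto 1).comp hs1).mul_const w
      simpa using this
    exact (hg.continuousOn.continuousAt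
      (Metric.isOpen_ball.mem_nhds (mem_ball_zero_iff.mpr hw))).tendsto.comp h1

theorem poissonKernel_zero_circleMap (θ : ℝ) : poissonKernel 0 0 (circleMap 0 1 θ) = 1 := by
  simp [poissonKernel_def]

/-- A sequence of radii increasing to `1`. -/
theorem exists_radii_tendsto_one : ∃ s : ℕ → ℝ, (∀ k, s k ∈ Set.Ioo (0 : ℝ) 1) ∧
    Tendsto s atTop (𝓝[<] 1) := by
  obtain ⟨s, -, hs, hs1⟩ := exists_seq_strictMono_tendsto' (zero_lt_one (α := ℝ))
  exact ⟨s, hs, tendsto_nhdsWithin_iff.mpr ⟨hs1, Filter.Eventually.of_forall fun k => (hs k).2⟩⟩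

/-- A holomorphic function on the disc with negative real part has radial limits almost
everywhere. -/
theorem ae_exists_radial_limit_of_re_neg {u : ℂ → ℂ}
    (hu : DifferentiableOn ℂ u (Metric.ball 0 1))
    (h0 : ∀ z ∈ Metric.ball (0 : ℂ) 1, (u z).re < 0) :
    ∀ᵐ θ : ℝ, ∃ w, Tendsto (fun r : ℝ => u (r * circleMap 0 1 θ)) (𝓝[<] 1) (𝓝 w) := by
  have h1u : ∀ z ∈ Metric.ball (0 : ℂ) 1, 1 < (1 - u z).re := fun z hz => by
    have := h0 z hz
    simp
    linarith
  have hnorm : ∀ z ∈ Metric.ball (0 : ℂ) 1, 1 < ‖1 - u z‖ := fun z hz =>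
    (h1u z hz).trans_le (Complex.re_le_norm _)
  have hne : ∀ z ∈ Metric.ball (0 : ℂ) 1, 1 - u z ≠ 0 := fun z hz h => by
    have := hnorm z hz
    rw [h, norm_zero] at this
    linarith
  have hin : ∀ r ∈ Set.Ioo (0 : ℝ) 1, ∀ θ : ℝ,
      (r * circleMap 0 1 θ : ℂ) ∈ Metric.ball (0 : ℂ) 1 := by
    intro r hr θ
    simpa [abs_of_pos hr.1] using hr.2
  -- Fatou's theorem applies to `(1 - u)⁻¹`, and `u` is recovered wherever the limit is nonzero.
  have hB := ae_exists_radial_limit_of_bounded (B := fun z => (1 - u z)⁻¹) (M := 1)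
    ((hu.const_sub 1).inv hne) fun z hz => by
      rw [norm_inv]
      exact inv_le_one_of_one_le₀ (hnorm z hz).le
  obtain ⟨s, hs, hs1⟩ := exists_radii_tendsto_one
  -- Since `log |1 - u|` is nonnegative and the real part of a holomorphic function, its lower limit
  -- along the radii is integrable over the circle. It is thus almost everywhere finite, which
  -- excludes the limit 0 for `(1 - u)⁻¹`.
  have hL := lintegral_liminf_poissonKernel_mul_re_le (g := fun z => Complex.log (1 - u z))
    ((hu.const_sub 1).clog fun z hz => Or.inl (by linarith [h1u z hz]))
    (fun z hz => by rw [Complex.log_re]; exact Real.log_nonneg (hnorm z hz).le)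
    (w := 0) (by simp) hs (hs1.mono_right nhdsWithin_le_nhds)
  simp only [poissonKernel_zero_circleMap, one_mul, Complex.log_re] at hL
  have hcont : ∀ k, Continuous fun θ : ℝ => u (s k * circleMap 0 1 θ) := fun k =>
    hu.continuousOn.comp_continuous (by fun_prop) (hin _ (hs k))
  have hfin : ∀ᵐ θ : ℝ, liminf (fun k => ENNReal.ofReal
      (Real.log ‖1 - u (s k * circleMap 0 1 θ)‖)) atTop < ⊤ := by
    have h2 := ae_lt_top' (μ := volume.restrict (Set.Ioc 0 (2 * Real.pi)))
      (f := fun θ : ℝ => liminf (fun k => ENNReal.ofReal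
      (Real.log ‖1 - u (s k * circleMap 0 1 θ)‖)) atTop)
      (Measurable.liminf fun k => by
        have := (hcont k).measurable
        exact (Real.measurable_log.comp (this.const_sub 1).norm).ennreal_ofReal).aemeasurable (hL.trans_lt ENNReal.ofReal_lt_top).ne
    have hfd := isAddFundamentalDomain_Ioc Real.two_pi_pos 0
    refine hfd.measure_zero_of_invariant _ (fun g => ?_) ?_
    · obtain ⟨_, k, rfl⟩ := g
      have hper := (periodic_circleMap 0 1).zsmul k
      ext θ
      rw [Set.mem_vadd_set_iff_neg_vadd_mem]
      have : circleMap 0 1 (-(k • (2 * Real.pi)) + θ) = circleMap 0 1 θ := by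
        rw [neg_add_eq_sub, hper.sub_eq]
      simp only [Set.mem_compl_iff, Set.mem_ofPred_eq]
      change ¬ (liminf (fun j => ENNReal.ofReal (Real.log ‖1 - u (s j * circleMap 0 1
        (-(k • (2 * Real.pi)) + θ))‖)) atTop < ⊤) ↔ _
      rw [this]
    · rw [zero_add, ← Measure.restrict_apply' measurableSet_Ioc]
      exact h2
  filter_upwards [hB, hfin] with θ ⟨b, hb⟩ hθ
  have hb0 : b ≠ 0 := by
    rintro rfl
    have h3 : Tendsto (fun k => ‖1 - u (s k * circleMap 0 1 θ)‖) atTop atTop := by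
      have h4 : Tendsto (fun k => ‖(1 - u (s k * circleMap 0 1 θ))⁻¹‖) atTop (𝓝[>] 0) := by
        refine tendsto_nhdsWithin_iff.mpr ⟨by simpa using (hb.comp hs1).norm, ?_⟩
        exact Filter.Eventually.of_forall fun k =>
          norm_pos_iff.mpr (inv_ne_zero (hne _ (hin _ (hs k) θ)))
      simpa [Function.comp_def] using tendsto_inv_nhdsGT_zero.comp h4
    have h5 := (ENNReal.tendsto_ofReal_atTop.comp (Real.tendsto_log_atTop.comp h3)).liminf_eq
    simp only [Function.comp_def] at h5
    rw [h5] at hθ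
    exact lt_irrefl _ hθ
  refine ⟨1 - b⁻¹, ((hb.inv₀ hb0).const_sub 1).congr fun r => ?_⟩
  simp

/-! ### Radial limits of discs in taut tubes -/

/-- The base of a taut tube contains no line. -/
theorem IsTaut.eq_zero_of_line_subset {n : ℕ} {Ω : Set (Fin n → ℝ)}
    (hD : IsTaut {z : Fin n → ℂ | (fun j => (z j).re) ∈ Ω}) {x v : Fin n → ℝ}
    (h : ∀ t : ℝ, x + t • v ∈ Ω) : v = 0 := by
  by_contra hv
  obtain ⟨j, hj⟩ := Function.ne_iff.mp hv
  -- These discs all pass through `x` at `0`, so they are not compactly divergent. At `1/2` they run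
  -- to infinity, so they do not converge.
  set F : ℕ → ℂ → Fin n → ℂ := fun k z i => x i + k * z * v i with hF
  have hx : (fun i => (x i : ℂ)) ∈ {z : Fin n → ℂ | (fun j => (z j).re) ∈ Ω} := by
    simpa using h 0
  rcases hD F fun k => ⟨by rw [hF]; fun_prop, fun z _ => by
    have := h (k * z.re)
    simp only [Set.mem_ofPred_eq, hF]
    convert this using 1
    ext i
    simp⟩ with ⟨s, hs, g, -, hg⟩ | ⟨s, hs, hdiv⟩
  · have h1 := tendsto_pi_nhds.mp (hg.tendsto_at (a := 1 / 2) (by norm_num)) j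
    have h2 : Tendsto (fun k => (s k : ℝ) * ‖(v j : ℂ) / 2‖) atTop atTop :=
      ((tendsto_natCast_atTop_atTop (R := ℝ)).comp hs.tendsto_atTop).atTop_mul_const
        (norm_pos_iff.mpr (div_ne_zero (by exact_mod_cast hj) two_ne_zero))
    have h3 := (h1.sub_const (x j : ℂ)).norm
    refine not_tendsto_nhds_of_tendsto_atTop h2 _ (h3.congr fun k => ?_)
    have : F (s k) (1 / 2) j - x j = (s k : ℝ) * ((v j : ℂ) / 2) := by
      simp only [hF]
      push_cast
      ring
    rw [this, norm_mul, Complex.norm_real, Real.norm_natCast]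
  · obtain ⟨k, hk⟩ := (hdiv {0} (by simp) isCompact_singleton {fun i => (x i : ℂ)}
      (Set.singleton_subset_iff.mpr hx) isCompact_singleton).exists
    refine Set.disjoint_left.mp hk ⟨0, rfl, rfl⟩ ?_
    simp [hF]

/-- The linear functionals bounded above on an open convex set containing no line span the dual
space. -/
theorem span_bddAbove_functionals_eq_top {E : Type*} [NormedAddCommGroup E] [NormedSpace ℝ E]
    [FiniteDimensional ℝ E] {Ω : Set E} (hΩ : IsOpen Ω) (hne : Ω.Nonempty) (hc : Convex ℝ Ω)
    (h : ∀ x v : E, (∀ t : ℝ, x + t • v ∈ Ω) → v = 0) :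
    Submodule.span ℝ {f : Module.Dual ℝ E | ∃ M, ∀ x ∈ Ω, f x < M} = ⊤ := by
  set W := Submodule.span ℝ {f : Module.Dual ℝ E | ∃ M, ∀ x ∈ Ω, f x < M}
  obtain ⟨x, hx⟩ := hne
  have hW : W.dualCoannihilator = ⊥ := by
    rw [Submodule.eq_bot_iff]
    intro v hv
    refine h x v fun t => ?_
    by_contra ht
    obtain ⟨f, hf⟩ := geometric_hahn_banach_open_point hc hΩ ht
    -- The separating functional is bounded above on the set, hence kills `v`, so it cannot separate
    -- `x + t • v` from `x`.
    have h1 := (Submodule.mem_dualCoannihilator v).mp hv f.toLinearMap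
      (Submodule.subset_span ⟨f (x + t • v), hf⟩)
    have h2 := hf x hx
    have h3 : f v = 0 := h1
    simp [h3] at h2
  have := Subspace.dualCoannihilator_dualAnnihilator_eq (W := W)
  rw [← this, hW, Submodule.dualAnnihilator_bot]

/-- Holomorphic discs in a taut convex tube have radial limits almost everywhere. -/
theorem IsHolomorphicDisc.ae_exists_hasRadialLimit {n : ℕ} {D : Set (Fin n → ℂ)}
    (hD : IsConvexTube D) (hDt : IsTaut D) {φ : ℂ → Fin n → ℂ} (hφ : IsHolomorphicDisc D φ) :
    ∀ᵐ ζ ∂circleLebesgue, ∃ w : Fin n → ℂ, HasRadialLimit φ ζ w := by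
  rw [ae_circleLebesgue_iff]
  obtain ⟨Ω, hΩ, hne, hc, rfl⟩ := hD
  have hspan := span_bddAbove_functionals_eq_top hΩ hne hc
    fun x v => hDt.eq_zero_of_line_subset
  have hφj := differentiableOn_pi.mp hφ.1
  have key : ∀ f : Module.Dual ℝ (Fin n → ℝ), ∀ᵐ θ : ℝ, ∃ w, Tendsto
      (fun r : ℝ => ∑ j, (f (Pi.single j 1) : ℂ) * φ (r * circleMap 0 1 θ) j) (𝓝[<] 1) (𝓝 w) := by
    intro f
    have hf : f ∈ Submodule.span ℝ {f : Module.Dual ℝ (Fin n → ℝ) | ∃ M, ∀ x ∈ Ω, f x < M} := by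
      rw [hspan]; trivial
    induction hf using Submodule.span_induction with
    | mem f hf =>
      obtain ⟨M, hM⟩ := hf
      have h1 := ae_exists_radial_limit_of_re_neg
        (u := fun z => (∑ j, (f (Pi.single j 1) : ℂ) * φ z j) - M)
        ((DifferentiableOn.fun_sum fun j _ => (hφj j).const_mul _).sub_const _) fun z hz => by
          have h2 := hM _ (hφ.2 hz)
          rw [LinearMap.pi_apply_eq_sum_univ f] at h2
          simp only [Complex.sub_re, Complex.re_sum, Complex.re_ofReal_mul, Complex.ofReal_re]
          refine sub_neg.mpr (lt_of_eq_of_lt (Finset.sum_congr rfl fun j _ => ?_) h2)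
          rw [smul_eq_mul, mul_comm]
          congr 2
          ext i
          simp [Pi.single_apply, eq_comm]
      filter_upwards [h1] with θ ⟨w, hw⟩
      exact ⟨w + M, (hw.add_const (M : ℂ)).congr fun r => by ring⟩
    | zero => exact Filter.Eventually.of_forall fun θ => ⟨0, by simp⟩
    | add f g _ _ hf hg =>
      filter_upwards [hf, hg] with θ ⟨w, hw⟩ ⟨w', hw'⟩
      refine ⟨w + w', (hw.add hw').congr fun r => ?_⟩
      rw [← Finset.sum_add_distrib]
      exact Finset.sum_congr rfl fun j _ => by
        simp only [LinearMap.add_apply, Complex.ofReal_add]; ring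
    | smul c f _ hf =>
      filter_upwards [hf] with θ ⟨w, hw⟩
      refine ⟨c * w, (hw.const_mul (c : ℂ)).congr fun r => ?_⟩
      rw [Finset.mul_sum]
      exact Finset.sum_congr rfl fun j _ => by
        simp only [LinearMap.smul_apply, smul_eq_mul, Complex.ofReal_mul]; ring
  have hall : ∀ᵐ θ : ℝ, ∀ j, ∃ w, Tendsto (fun r : ℝ => φ (r * circleMap 0 1 θ) j)
      (𝓝[<] 1) (𝓝 w) := by
    refine ae_all_iff.mpr fun j => ?_
    filter_upwards [key (LinearMap.proj j)] with θ ⟨w, hw⟩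
    refine ⟨w, hw.congr fun r => ?_⟩
    rw [Finset.sum_eq_single j]
    · simp
    · intro i _ hij
      simp [hij.symm]
    · simp
  filter_upwards [hall] with θ hθ
  choose w hw using hθ
  exact ⟨w, tendsto_pi_nhds.mpr hw⟩

/-! ### Boundary maximum principle and infinitesimal generators -/

/-- A holomorphic function on the disc with real part bounded above whose radial limits have
nonpositive real part almost everywhere has nonpositive real part. -/
theorem re_nonpos_of_radial_limits {K : ℂ → ℂ} (hK : DifferentiableOn ℂ K (Metric.ball 0 1))
    {M : ℝ} (hM : ∀ z ∈ Metric.ball (0 : ℂ) 1, (K z).re ≤ M)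
    (hlim : ∀ᵐ θ : ℝ, ∃ k : ℂ, Tendsto (fun r : ℝ => K (r * circleMap 0 1 θ)) (𝓝[<] 1) (𝓝 k) ∧
      k.re ≤ 0) {w : ℂ} (hw : w ∈ Metric.ball 0 1) : (K w).re ≤ 0 := by
  wlog hM0 : 0 ≤ M generalizing M
  · exact this (M := 0) (fun z hz => (hM z hz).trans (le_of_not_ge hM0)) le_rfl
  rw [mem_ball_zero_iff] at hw
  obtain ⟨s, hs, hs1⟩ := exists_radii_tendsto_one
  have h1 := lintegral_liminf_poissonKernel_mul_re_le (g := fun z => M - K z) (hK.const_sub _)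
    (fun z hz => by simpa using hM z hz) hw hs (hs1.mono_right nhdsWithin_le_nhds)
  have h2 := lintegral_poissonKernel_mul_re (g := fun _ => (M : ℂ)) (differentiableOn_const _)
    (fun _ _ => by simpa using hM0) hw
  -- Almost everywhere the boundary value of `M - Re K` is at least `M`. Fatou's lemma turns this
  -- into `M ≤ M - Re K(w)`.
  have h3 : ∫⁻ θ in Set.Ioc 0 (2 * Real.pi), ENNReal.ofReal
      (poissonKernel 0 w (circleMap 0 1 θ) * (M : ℂ).re) ≤
      ∫⁻ θ in Set.Ioc 0 (2 * Real.pi), liminf (fun k => ENNReal.ofReal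
      (poissonKernel 0 w (circleMap 0 1 θ) * (M - K (s k * circleMap 0 1 θ)).re)) atTop := by
    refine lintegral_mono_ae (ae_restrict_of_ae ?_)
    filter_upwards [hlim] with θ ⟨k, hk, hk0⟩
    have h4 : Tendsto (fun j => ENNReal.ofReal (poissonKernel 0 w (circleMap 0 1 θ) *
        (M - K (s j * circleMap 0 1 θ)).re)) atTop
        (𝓝 (ENNReal.ofReal (poissonKernel 0 w (circleMap 0 1 θ) * (M - k).re))) :=
      (ENNReal.continuous_ofReal.tendsto _).comp (Tendsto.const_mul _
        ((Complex.continuous_re.tendsto _).comp ((hk.comp hs1).const_sub _)))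
    rw [h4.liminf_eq]
    refine ENNReal.ofReal_le_ofReal (mul_le_mul_of_nonneg_left ?_
      (poissonKernel_circleMap_pos hw θ).le)
    simpa using hk0
  have h4 := (h2.symm.le.trans h3).trans h1
  rw [ENNReal.ofReal_le_ofReal_iff'] at h4
  have hpi := Real.two_pi_pos
  simp only [Complex.ofReal_re, Complex.sub_re] at h4
  rcases h4 with h4 | h4
  · have := le_of_mul_le_mul_left h4 hpi
    linarith
  · have h5 : M = 0 := le_antisymm (nonpos_of_mul_nonpos_right h4 hpi) hM0
    exact h5 ▸ hM w (mem_ball_zero_iff.mpr hw)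

/-- On circles close to the unit circle, a strict infinitesimal generator points inwards. -/
theorem re_conj_mul_neg_of_strict_generator {W : ℂ → ℂ} {ε : ℝ} (hε : 0 < ε)
    (h : ∀ z ∈ Metric.ball (0 : ℂ) 1,
      (conj z * (W z - W 0 + conj (W 0) * z ^ 2)).re ≤ -ε * ‖z‖ ^ 2) :
    ∀ᶠ r : ℝ in 𝓝[<] 1, ∀ z, ‖z‖ = r → (conj z * W z).re < 0 := by
  have h1 : ∀ᶠ r : ℝ in 𝓝 1, ‖W 0‖ * (1 - r ^ 2) < ε * r := by
    have hc1 : ContinuousAt (fun r : ℝ => ‖W 0‖ * (1 - r ^ 2)) 1 := by fun_prop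
    have hc2 : ContinuousAt (fun r : ℝ => ε * r) 1 := by fun_prop
    exact hc1.eventually_lt hc2 (by simpa using hε)
  filter_upwards [nhdsWithin_le_nhds h1, Ioo_mem_nhdsLT (zero_lt_one (α := ℝ))] with r hr hr1 z hz
  have h2 := h z (by rw [mem_ball_zero_iff, hz]; exact hr1.2)
  have e : conj z * (W z - W 0 + conj (W 0) * z ^ 2) =
      conj z * W z - conj z * W 0 + (‖z‖ ^ 2 : ℝ) * conj (conj z * W 0) := by
    rw [map_mul, Complex.conj_conj, Complex.ofReal_pow, ← Complex.conj_mul']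
    ring
  rw [e, Complex.add_re, Complex.sub_re, Complex.re_ofReal_mul, Complex.conj_re, hz] at h2
  have h3 : (conj z * W 0).re ≤ r * ‖W 0‖ := by
    refine (Complex.re_le_norm _).trans_eq ?_
    rw [norm_mul, RCLike.norm_conj, hz]
  have h4 : 0 ≤ 1 - r ^ 2 := by nlinarith [hr1.1, hr1.2]
  nlinarith [mul_le_mul_of_nonneg_right h3 h4, mul_lt_mul_of_pos_left hr hr1.1]

/-- A strict infinitesimal generator on the disc has exactly one zero, which is simple. -/
theorem exists_unique_simple_zero_of_strict_generator {W : ℂ → ℂ} {ε : ℝ} (hε : 0 < ε)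
    (hW : DifferentiableOn ℂ W (Metric.ball 0 1))
    (h : ∀ z ∈ Metric.ball (0 : ℂ) 1,
      (conj z * (W z - W 0 + conj (W 0) * z ^ 2)).re ≤ -ε * ‖z‖ ^ 2) :
    ∃ α ∈ Metric.ball (0 : ℂ) 1, W α = 0 ∧ deriv W α ≠ 0 ∧
      ∀ β ∈ Metric.ball (0 : ℂ) 1, W β = 0 → β = α := by
  have hev := (re_conj_mul_neg_of_strict_generator hε h).and
    (Ioo_mem_nhdsLT (zero_lt_one (α := ℝ)))
  have hdc : ∀ r < (1 : ℝ), ∀ {g : ℂ → ℂ}, DifferentiableOn ℂ g (Metric.closedBall 0 r) →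
      DiffContOnCl ℂ g (Metric.ball 0 r) := fun r _ g hg => hg.diffContOnCl_ball subset_rfl
  have hex : ∃ α ∈ Metric.ball (0 : ℂ) 1, W α = 0 := by
    by_contra! hne
    obtain ⟨r, hr, hr1⟩ := hev.exists
    have hsub := Metric.closedBall_subset_ball (x := (0 : ℂ)) hr1.2
    -- Without zeros of `W`, the function `z / W z` would be holomorphic with negative real part on
    -- the circle, yet it vanishes at 0.
    have h1 := re_neg_of_re_neg_on_sphere (g := fun z => z / W z) hr1.1
      (hdc r hr1.2 ((differentiableOn_id.div (hW.mono hsub) fun z hz => hne z (hsub hz))))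
      (fun z hz => by
        have hWz : W z ≠ 0 := hne z (hsub (by rw [mem_closedBall_zero_iff, hz]))
        have e : z / W z = ((‖W z‖ ^ 2)⁻¹ : ℝ) * conj (conj z * W z) := by
          rw [map_mul, Complex.conj_conj, Complex.ofReal_inv, Complex.ofReal_pow,
            ← Complex.mul_conj', div_eq_iff hWz]
          have : conj (W z) ≠ 0 := by simpa using hWz
          field_simp
        rw [e, Complex.re_ofReal_mul, Complex.conj_re]
        exact mul_neg_of_pos_of_neg (by positivity) (hr z hz))
      (z := 0) (by simpa using hr1.1)
    simp at h1
  have hds : ∀ α ∈ Metric.ball (0 : ℂ) 1, W α = 0 → ∀ β ∈ Metric.ball (0 : ℂ) 1,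
      dslope W α β ≠ 0 := by
    intro α hα hWα β hβ
    rw [mem_ball_zero_iff] at hα hβ
    obtain ⟨r, ⟨hr, hr1⟩, hrα⟩ := (hev.and (Ioo_mem_nhdsLT (max_lt hα hβ))).exists
    have hα' : ‖α‖ < r := (le_max_left _ _).trans_lt hrα.1
    have hβ' : ‖β‖ < r := (le_max_right _ _).trans_lt hrα.1
    have hsub := Metric.closedBall_subset_ball (x := (0 : ℂ)) hr1.2
    have hdd : DifferentiableOn ℂ (dslope W α) (Metric.ball 0 1) :=
      (Complex.differentiableOn_dslope
        (Metric.isOpen_ball.mem_nhds (mem_ball_zero_iff.mpr hα))).mpr hW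
    have hden : ∀ z, ‖z‖ ≤ r → (r ^ 2 : ℂ) - conj α * z ≠ 0 := by
      intro z hz h0
      have h2 : ‖conj α * z‖ = r ^ 2 := by
        rw [← sub_eq_zero.mp h0, norm_pow, Complex.norm_real, Real.norm_of_nonneg hr1.1.le]
      rw [norm_mul, RCLike.norm_conj] at h2
      nlinarith [norm_nonneg α, norm_nonneg z, hr1.1]
    -- On `|z| = r` the denominator equals `z * conj (z - α)`, so the quotient is a positive
    -- multiple of `conj z * W z`. Its real part stays negative inside, and hence `W` divided by `z
    -- - α` has no zero.
    have h1 := re_neg_of_re_neg_on_sphere (g := fun z => dslope W α z / (r ^ 2 - conj α * z))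
      hr1.1 (hdc r hr1.2 ((hdd.mono hsub).div (by fun_prop) fun z hz =>
        hden z (mem_closedBall_zero_iff.mp hz))) (fun z hz => by
        have hzα : z - α ≠ 0 := sub_ne_zero.mpr fun h0 => by
          rw [← h0, hz] at hα'; exact lt_irrefl _ hα'
        have hz0 : z ≠ 0 := norm_pos_iff.mp (hz ▸ hr1.1)
        have e1 : (r ^ 2 : ℂ) - conj α * z = z * conj (z - α) := by
          rw [map_sub, mul_sub, Complex.mul_conj', hz]; ring
        have e2 : dslope W α z = W z / (z - α) := by
          have := sub_smul_dslope W α z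
          rw [hWα, sub_zero, smul_eq_mul] at this
          rw [eq_div_iff hzα, mul_comm, this]
        have e : dslope W α z / (r ^ 2 - conj α * z) =
            ((‖z‖ ^ 2 * ‖z - α‖ ^ 2)⁻¹ : ℝ) * (conj z * W z) := by
          rw [e1, e2, Complex.ofReal_inv, Complex.ofReal_mul, Complex.ofReal_pow,
            Complex.ofReal_pow, ← Complex.mul_conj', ← Complex.mul_conj']
          have h3 : conj z ≠ 0 := by simpa using hz0
          have h4 : conj (z - α) ≠ 0 := (map_ne_zero _).mpr hzα
          generalize conj (z - α) = p at *
          generalize z - α = q at *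
          field_simp
        rw [e, Complex.re_ofReal_mul]
        have := norm_pos_iff.mpr hzα
        have := norm_pos_iff.mpr hz0
        exact mul_neg_of_pos_of_neg (by positivity) (hr z hz)) hβ'
    intro h0
    simp [h0] at h1
  obtain ⟨α, hα, hWα⟩ := hex
  refine ⟨α, hα, hWα, by simpa using hds α hα hWα α hα, fun β hβ hWβ => ?_⟩
  by_contra hne
  have h1 := sub_smul_dslope W α β
  rw [hWα, hWβ, sub_zero, smul_eq_mul] at h1
  exact (mul_ne_zero (sub_ne_zero.mpr hne) (hds α hα hWα β hβ)) h1

/-! ### Sufficiency of the conditions -/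

theorem poincareDist_comp_le {f : ℂ → ℂ} (hf : DifferentiableOn ℂ f (Metric.ball 0 1))
    (hm : Set.MapsTo f (Metric.ball 0 1) (Metric.ball 0 1)) {z w : ℂ} (hz : ‖z‖ < 1)
    (hw : ‖w‖ < 1) : poincareDist (f z) (f w) ≤ poincareDist z w := by
  have hfw : ‖f w‖ < 1 := by simpa using hm (mem_ball_zero_iff.mpr hw)
  have hfz : ‖f z‖ < 1 := by simpa using hm (mem_ball_zero_iff.mpr hz)
  have h := norm_sub_le_of_mapsTo_ball hf hm hz hw
  have h0 := one_sub_conj_mul_ne_zero hfw hfz.le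
  have h1 : ‖discMoebius (f w) (f z)‖ ≤ ‖discMoebius w z‖ := by
    rwa [discMoebius, norm_div, div_le_iff₀ (norm_pos_iff.mpr h0)]
  refine Real.artanh_le_artanh ?_ (norm_discMoebius_lt_one hw hz) h1
  linarith [norm_nonneg ((f z - f w) / (1 - conj (f w) * f z))]

theorem continuousAt_artanh {x : ℝ} (hx : x ∈ Set.Ioo (-1 : ℝ) 1) :
    ContinuousAt Real.artanh x := by
  have h1 : 0 < (1 + x) / (1 - x) := div_pos (by linarith [hx.1]) (by linarith [hx.2])
  have h2 : ContinuousAt (fun x : ℝ => √((1 + x) / (1 - x))) x :=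
    (ContinuousAt.div (by fun_prop) (by fun_prop) (by linarith [hx.2])).sqrt
  exact h2.log (Real.sqrt_pos.mpr h1).ne'

theorem tendsto_poincareDist {ι : Type*} {l : Filter ι} {u v : ι → ℂ} {z w : ℂ} (hz : ‖z‖ < 1)
    (hw : ‖w‖ < 1) (hu : Tendsto u l (𝓝 z)) (hv : Tendsto v l (𝓝 w)) :
    Tendsto (fun i => poincareDist (u i) (v i)) l (𝓝 (poincareDist z w)) := by
  have h1 := norm_discMoebius_lt_one hw hz
  have h2 : Tendsto (fun i => ‖discMoebius (v i) (u i)‖) l (𝓝 ‖discMoebius w z‖) :=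
    ((hu.sub hv).div ((((Complex.continuous_conj.tendsto _).comp hv).mul hu).const_sub 1)
      (one_sub_conj_mul_ne_zero hw hz.le)).norm
  exact (continuousAt_artanh ⟨by linarith [norm_nonneg (discMoebius w z)], h1⟩).tendsto.comp h2

/-- A scalar holomorphic implicit function: the unique zero of a holomorphic family depends
holomorphically on the parameter. -/
theorem differentiableAt_of_unique_simple_zero {E : Type*} [NormedAddCommGroup E]
    [NormedSpace ℂ E] [CompleteSpace E] {Φ : E × ℂ → ℂ} {f : E → ℂ} {x : E}
    (hΦ : ContDiffAt ℂ 1 Φ (x, f x)) (h0 : Φ (x, f x) = 0) {d : ℂ} (hd : d ≠ 0)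
    (hΦd : HasDerivAt (fun z => Φ (x, z)) d (f x)) {U : Set ℂ} (hU : U ∈ 𝓝 (f x))
    (huniq : ∀ᶠ y in 𝓝 x, ∀ z ∈ U, Φ (y, z) = 0 → z = f y) : DifferentiableAt ℂ f x := by
  have hF : HasFDerivAt Φ (fderiv ℂ Φ (x, f x)) (x, f x) :=
    (hΦ.differentiableAt one_ne_zero).hasFDerivAt
  have h1 : fderiv ℂ Φ (x, f x) ((0 : E), (1 : ℂ)) = d := by
    have h2 : HasDerivAt (fun z : ℂ => (x, z)) ((0 : E), (1 : ℂ)) (f x) :=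
      (hasDerivAt_const _ _).prodMk (hasDerivAt_id _)
    exact (hF.comp_hasDerivAt (f x) h2).unique hΦd
  have h2 : ∀ t : ℂ, fderiv ℂ Φ (x, f x) ((0 : E), t) = t * d := by
    intro t
    rw [← h1, ← smul_eq_mul, ← map_smul]
    simp
  have hinv : (fderiv ℂ Φ (x, f x) ∘L .inr ℂ E ℂ).IsInvertible := by
    refine ContinuousLinearMap.IsInvertible.of_inverse (g := d⁻¹ • .id ℂ ℂ) ?_ ?_
    · ext
      simp [h2, hd]
    · ext
      simp [h2, hd]
  -- The implicit solution stays in `U` near `x`, so uniqueness of the zero identifies it with `f`.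
  -- Continuity of `f` need not be known beforehand.
  set ψ := hΦ.implicitFunction one_ne_zero hinv
  have hψx : ψ x = f x := hΦ.implicitFunction_apply_self one_ne_zero hinv
  have hψd : DifferentiableAt ℂ ψ x :=
    (hΦ.hasStrictFDerivAt_implicitFunction one_ne_zero hinv).hasFDerivAt.differentiableAt
  refine hψd.congr_of_eventuallyEq ?_
  have hψU : ∀ᶠ y in 𝓝 x, ψ y ∈ U := hψd.continuousAt.preimage_mem_nhds (by rwa [hψx])
  filter_upwards [huniq, hψU, hΦ.eventually_apply_implicitFunction one_ne_zero hinv]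
    with y hy hyU hyΦ
  exact (hy _ hyU (hyΦ.trans h0)).symm

/-- Sufficient condition for complex geodesics: a self-conjugate quadratic polynomial map that is
a.e. a supporting functional along the boundary of the disc. -/
theorem IsHolomorphicDisc.isComplexGeodesic_of_quadratic {n : ℕ} {D : Set (Fin n → ℂ)}
    (hD : IsOpen D) {φ : ℂ → Fin n → ℂ} (hφ : IsHolomorphicDisc D φ) (a : Fin n → ℂ)
    (b : Fin n → ℝ) {h : ℂ → Fin n → ℂ}
    (hh : ∀ (z : ℂ) (j : Fin n), h z j = conj (a j) * z ^ 2 + (b j : ℂ) * z + a j)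
    (hi : ∀ᵐ ζ ∂circleLebesgue, ∃ w : Fin n → ℂ, HasRadialLimit φ ζ w ∧
      ∀ z ∈ D, (conj ζ * (h ζ ⬝ᵥ (z - w))).re < 0)
    (hii : ∀ z ∈ Metric.ball (0 : ℂ) 1, z ≠ 0 →
      (h z ⬝ᵥ (z⁻¹ • (φ 0 - φ z))).re < 0) : IsComplexGeodesic D φ := by
  obtain rfl : h = fun z j => conj (a j) * z ^ 2 + (b j : ℂ) * z + a j :=
    funext fun z => funext fun j => hh z j
  set h : ℂ → Fin n → ℂ := fun z j => conj (a j) * z ^ 2 + (b j : ℂ) * z + a j with hhdef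
  have h0 := zero_mem_ball_zero_one
  have hball : Metric.ball (0 : ℂ) 1 ∈ 𝓝 0 := Metric.ball_mem_nhds _ one_pos
  have hhd : ∀ j, Differentiable ℂ fun z => h z j := fun j => by rw [hhdef]; fun_prop
  have hhc : Continuous h := by rw [hhdef]; fun_prop
  have hφj := differentiableOn_pi.mp hφ.1
  have hVd : ∀ x : Fin n → ℂ, DifferentiableOn ℂ (fun z => h z ⬝ᵥ (x - φ z)) (Metric.ball 0 1) :=
    fun x => DifferentiableOn.fun_sum fun j _ =>
      (hhd j).differentiableOn.mul ((hφj j).const_sub _)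
  set N : ℂ → ℂ := fun z => h z ⬝ᵥ (φ 0 - φ z) with hN
  have hN0 : N 0 = 0 := by simp [hN]
  have hSd : DifferentiableOn ℂ (dslope N 0) (Metric.ball 0 1) :=
    (Complex.differentiableOn_dslope hball).mpr (hVd (φ 0))
  have hNS : ∀ z, N z = z * dslope N 0 z := by
    intro z
    have := sub_smul_dslope N 0 z
    simpa [hN0] using this.symm
  have hSne : ∀ z ∈ Metric.ball (0 : ℂ) 1, z ≠ 0 → (dslope N 0 z).re < 0 := by
    intro z hz hz0
    have := hii z hz hz0
    rw [dotProduct_smul] at this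
    change (z⁻¹ • N z).re < 0 at this
    rwa [hNS, smul_eq_mul, inv_mul_cancel_left₀ hz0] at this
  have hS0 : (dslope N 0 0).re < 0 := by
    have hhalf : (0 : ℝ) < 1 / 2 := by norm_num
    refine re_neg_of_re_neg_on_sphere hhalf (DifferentiableOn.diffContOnCl_ball (hSd.mono
      (Metric.closedBall_subset_ball (by norm_num))) subset_rfl) (fun z hz => ?_) (by simp)
    refine hSne z (by rw [mem_ball_zero_iff, hz]; norm_num) ?_
    rw [← norm_pos_iff, hz]
    exact hhalf
  set κ : ℂ := h 0 ⬝ᵥ deriv φ 0 with hκ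
  have hφ0 : HasDerivAt φ (deriv φ 0) 0 := (hφ.1.differentiableAt hball).hasDerivAt
  have hφ0j := hasDerivAt_pi.mp hφ0
  have hκS : dslope N 0 0 = -κ := by
    rw [dslope_same]
    have h3 : HasDerivAt N (∑ j, (deriv (fun z => h z j) 0 * (φ 0 j - φ 0 j) +
        h 0 j * -(deriv φ 0 j))) 0 :=
      HasDerivAt.fun_sum fun j _ => ((hhd j) 0).hasDerivAt.mul ((hφ0j j).const_sub _)
    rw [h3.deriv]
    simp [hκ, dotProduct]
  have hκre : 0 < κ.re := by
    rw [hκS, Complex.neg_re] at hS0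
    linarith
  have hi' := ae_circleLebesgue_iff.mp hi
  have hgen : ∀ x ∈ D, ∀ z ∈ Metric.ball (0 : ℂ) 1, (conj z * (h z ⬝ᵥ (x - φ z) -
      h 0 ⬝ᵥ (x - φ 0) + conj (h 0 ⬝ᵥ (x - φ 0)) * z ^ 2)).re ≤ 0 := by
    intro x hx z hz
    set c := h 0 ⬝ᵥ (x - φ 0) with hc
    -- Dividing `V_x(z) - c + conj c * z²` by `z` leaves a polynomial `q`, bounded on the disc, plus
    -- the slope of `N`, whose real part is negative by (ii). This is the upper bound needed to use
    -- boundary values.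
    set q : ℂ → ℂ := fun z => (∑ j, (conj (a j) * z + b j) * (x j - φ 0 j)) + conj c * z with hq
    set K : ℂ → ℂ := fun z => q z + dslope N 0 z with hK
    have hqd : Differentiable ℂ q := by rw [hq]; fun_prop
    have hKd : DifferentiableOn ℂ K (Metric.ball 0 1) := hqd.differentiableOn.add hSd
    have hKV : ∀ z, h z ⬝ᵥ (x - φ z) - c + conj c * z ^ 2 = z * K z := by
      intro z
      have e1 : h z ⬝ᵥ (x - φ z) = h z ⬝ᵥ (x - φ 0) + N z := by
        rw [hN, ← dotProduct_add, sub_add_sub_cancel]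
      have e2 : h z ⬝ᵥ (x - φ 0) - c = z * ∑ j, (conj (a j) * z + b j) * (x j - φ 0 j) := by
        rw [hc, ← sub_dotProduct, dotProduct, Finset.mul_sum]
        refine Finset.sum_congr rfl fun j _ => ?_
        simp only [hhdef, Pi.sub_apply]
        ring
      rw [hK, e1, hNS, mul_add, hq]
      linear_combination e2
    obtain ⟨M, hM⟩ := (isCompact_closedBall (0 : ℂ) 1).exists_bound_of_continuousOn
      hqd.continuous.continuousOn
    have hKM : ∀ z ∈ Metric.ball (0 : ℂ) 1, (K z).re ≤ M := by
      intro z hz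
      have h1 : (dslope N 0 z).re < 0 := by
        by_cases hz0 : z = 0
        · rwa [hz0]
        · exact hSne z hz hz0
      have h2 := (Complex.re_le_norm (q z)).trans (hM z (Metric.ball_subset_closedBall hz))
      rw [hK, Complex.add_re]
      linarith
    have hKre : (K z).re ≤ 0 := by
      refine re_nonpos_of_radial_limits hKd hKM ?_ hz
      filter_upwards [hi'] with θ ⟨w, hw, hneg⟩
      set ζ := circleMap 0 1 θ
      have hζ : ζ ≠ 0 := circleMap_ne_center one_ne_zero
      have hζn : ‖ζ‖ = 1 := by simp [ζ]
      have hr : Tendsto (fun r : ℝ => (r : ℂ) * ζ) (𝓝[<] 1) (𝓝 ζ) := by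
        have : ContinuousAt (fun r : ℝ => (r : ℂ) * ζ) 1 := by fun_prop
        simpa using this.tendsto.mono_left nhdsWithin_le_nhds
      refine ⟨(h ζ ⬝ᵥ (x - w) - c + conj c * ζ ^ 2) / ζ, ?_, ?_⟩
      · have hcd : Continuous fun p : ℂ × (Fin n → ℂ) =>
            h p.1 ⬝ᵥ (x - p.2) - c + conj c * p.1 ^ 2 := by
          simp only [dotProduct]
          fun_prop
        refine (((hcd.tendsto (ζ, w)).comp (hr.prodMk_nhds hw)).div hr hζ).congr' ?_
        filter_upwards [Ioo_mem_nhdsLT (zero_lt_one (α := ℝ))] with r hr1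
        have : (r * ζ : ℂ) ≠ 0 := mul_ne_zero (by exact_mod_cast hr1.1.ne') hζ
        simp only [Pi.div_apply, Function.comp]
        rw [hKV, mul_div_cancel_left₀ _ this]
      · have h2 : conj ζ * ζ = 1 := by
          rw [mul_comm, Complex.mul_conj', hζn]; simp
        have h3 : (h ζ ⬝ᵥ (x - w) - c + conj c * ζ ^ 2) / ζ =
            conj ζ * (h ζ ⬝ᵥ (x - w)) + (conj (conj ζ * c) - conj ζ * c) := by
          rw [map_mul, Complex.conj_conj, div_eq_iff hζ]
          linear_combination (c - h ζ ⬝ᵥ (x - w)) * h2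
        rw [h3]
        simpa using (hneg x hx).le
    rw [hKV, ← mul_assoc, ← Complex.normSq_eq_conj_mul_self, Complex.re_ofReal_mul]
    exact mul_nonpos_of_nonneg_of_nonpos (Complex.normSq_nonneg z) hKre
  -- Subtracting `ε z` makes the generator inequality strict. The unique zero of the perturbed
  -- function is taken as the value at `x` of an approximate left inverse.
  have hzero : ∀ ε : ℝ, 0 < ε → ∀ x, ∃ α, x ∈ D → α ∈ Metric.ball (0 : ℂ) 1 ∧
      h α ⬝ᵥ (x - φ α) - ε * α = 0 ∧ deriv (fun z => h z ⬝ᵥ (x - φ z) - ε * z) α ≠ 0 ∧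
      ∀ β ∈ Metric.ball (0 : ℂ) 1, h β ⬝ᵥ (x - φ β) - ε * β = 0 → β = α := by
    intro ε hε x
    by_cases hx : x ∈ D
    · obtain ⟨α, h1, h2, h3, h4⟩ := exists_unique_simple_zero_of_strict_generator hε
        (W := fun z => h z ⬝ᵥ (x - φ z) - ε * z) ((hVd x).sub (by fun_prop)) (fun z hz => by
          have h1 := hgen x hx z hz
          have e : conj z * (h z ⬝ᵥ (x - φ z) - ε * z - (h 0 ⬝ᵥ (x - φ 0) - ε * 0) +
              conj (h 0 ⬝ᵥ (x - φ 0) - ε * 0) * z ^ 2) = conj z * (h z ⬝ᵥ (x - φ z) -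
              h 0 ⬝ᵥ (x - φ 0) + conj (h 0 ⬝ᵥ (x - φ 0)) * z ^ 2) - (ε * ‖z‖ ^ 2 : ℝ) := by
            rw [mul_zero, sub_zero, Complex.ofReal_mul, Complex.ofReal_pow, ← Complex.conj_mul']
            ring
          rw [e, Complex.sub_re, Complex.ofReal_re]
          linarith)
      exact ⟨α, fun _ => ⟨h1, h2, h3, h4⟩⟩
    · exact ⟨0, fun hx' => absurd hx' hx⟩
  choose! f hf using hzero
  have hfm : ∀ ε : ℝ, 0 < ε → Set.MapsTo (f ε) D (Metric.ball 0 1) := fun ε hε x hx =>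
    (hf ε hε x hx).1
  have hfd : ∀ ε : ℝ, 0 < ε → DifferentiableOn ℂ (f ε) D := by
    intro ε hε x hx
    obtain ⟨h1, h2, h3, h4⟩ := hf ε hε x hx
    refine DifferentiableAt.differentiableWithinAt ?_
    have hφc : ContDiffAt ℂ 1 φ (f ε x) :=
      (hφ.1.contDiffOn Metric.isOpen_ball).contDiffAt (Metric.isOpen_ball.mem_nhds h1)
    refine differentiableAt_of_unique_simple_zero
      (Φ := fun p : (Fin n → ℂ) × ℂ => h p.2 ⬝ᵥ (p.1 - φ p.2) - ε * p.2) ?_ h2 h3 ?_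
      (Metric.isOpen_ball.mem_nhds h1) ?_
    · have hφ2 : ContDiffAt ℂ 1 (fun p : (Fin n → ℂ) × ℂ => φ p.2) (x, f ε x) :=
        ContDiffAt.comp (x, f ε x) (g := φ) hφc contDiffAt_snd
      have hφ2j := contDiffAt_pi.mp hφ2
      refine ContDiffAt.sub (ContDiffAt.sum fun j _ => ?_) (by fun_prop)
      simp only [hhdef, Pi.sub_apply]
      have := hφ2j j
      fun_prop
    · refine DifferentiableAt.hasDerivAt (f := fun z => h z ⬝ᵥ (x - φ z) - ε * z) ?_
      exact ((hVd x).differentiableAt (Metric.isOpen_ball.mem_nhds h1)).sub (by fun_prop)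
    · filter_upwards [hD.mem_nhds hx] with y hy z hz hzy
      exact (hf ε hε y hy).2.2.2 z hz hzy
  have hu0 : ∀ ε : ℝ, 0 < ε → f ε (φ 0) = 0 := fun ε hε =>
    ((hf ε hε _ (hφ.2 h0)).2.2.2 0 h0 (by simp)).symm
  have hud : ∀ ε : ℝ, 0 < ε → DifferentiableOn ℂ (fun z => f ε (φ z)) (Metric.ball 0 1) :=
    fun ε hε => (hfd ε hε).comp hφ.1 hφ.2
  have hu' : ∀ ε : ℝ, 0 < ε → deriv (fun z => f ε (φ z)) 0 = κ / (κ + ε) := by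
    intro ε hε
    set u : ℂ → ℂ := fun z => f ε (φ z) with hu
    have hud0 : HasDerivAt u (deriv u 0) 0 := ((hud ε hε).differentiableAt hball).hasDerivAt
    have hu00 : u 0 = 0 := hu0 ε hε
    have hφu : ∀ j, HasDerivAt (fun z => φ (u z) j) (deriv φ 0 j * deriv u 0) 0 := fun j => by
      have h1 : HasDerivAt (fun z => φ z j) (deriv φ 0 j) (u 0) := by rw [hu00]; exact hφ0j j
      exact h1.comp 0 hud0
    have hhu : ∀ j, DifferentiableAt ℂ (fun z => h (u z) j) 0 := fun j =>
      ((hhd j) (u 0)).comp (0 : ℂ) hud0.differentiableAt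
    -- Differentiating the defining equation of `u` at 0 gives `κ (1 - u'(0)) = ε u'(0)`.
    have h1 : HasDerivAt (fun z => h (u z) ⬝ᵥ (φ z - φ (u z)) - ε * u z)
        ((∑ j, (deriv (fun z => h (u z) j) 0 * (φ 0 j - φ (u 0) j) +
          h (u 0) j * (deriv φ 0 j - deriv φ 0 j * deriv u 0))) - ε * deriv u 0) 0 :=
      (HasDerivAt.fun_sum fun j _ => (hhu j).hasDerivAt.mul ((hφ0j j).sub (hφu j))).sub
        (hud0.const_mul _)
    have h2 : HasDerivAt (fun z => h (u z) ⬝ᵥ (φ z - φ (u z)) - ε * u z) 0 0 :=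
      (hasDerivAt_const (0 : ℂ) (0 : ℂ)).congr_of_eventuallyEq (by
        filter_upwards [hball] with z hz using (hf ε hε _ (hφ.2 hz)).2.1)
    have h3 := h1.unique h2
    have h4 : ∑ j, (deriv (fun z => h (u z) j) 0 * (φ 0 j - φ (u 0) j) +
        h (u 0) j * (deriv φ 0 j - deriv φ 0 j * deriv u 0)) = κ * (1 - deriv u 0) := by
      rw [hu00, hκ, dotProduct, Finset.sum_mul]
      exact Finset.sum_congr rfl fun j _ => by ring
    rw [h4] at h3
    have h5 : κ + ε ≠ 0 := fun h6 => by
      have := congrArg Complex.re h6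
      simp at this
      linarith
    rw [eq_div_iff h5]
    linear_combination -h3
  have hlim : ∀ z ∈ Metric.ball (0 : ℂ) 1,
      Tendsto (fun ε : ℝ => f ε (φ z)) (𝓝[>] 0) (𝓝 z) := by
    intro z hz
    refine tendsto_self_of_tendsto_dslope (u := fun (ε : ℝ) z => f ε (φ z)) (x := 0) (by simp)
      ?_ ?_ (mem_ball_zero_iff.mp hz)
    · filter_upwards [self_mem_nhdsWithin] with ε hε
      exact ⟨hud ε hε, (hfm ε hε).comp hφ.2, hu0 ε hε⟩
    · have hκ0 : κ ≠ 0 := fun h => by simp [h] at hκre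
      have h1 : Tendsto (fun ε : ℝ => κ / (κ + ε)) (𝓝[>] 0) (𝓝 1) := by
        have : ContinuousAt (fun ε : ℝ => κ / (κ + ε)) 0 :=
          ContinuousAt.div (by fun_prop) (by fun_prop) (by simpa using hκ0)
        have h2 := this.tendsto.mono_left (nhdsWithin_le_nhds (s := Set.Ioi 0))
        simpa [hκ0] using h2
      refine h1.congr' ?_
      filter_upwards [self_mem_nhdsWithin] with ε hε
      rw [dslope_same, hu' ε hε]
  refine ⟨hφ, fun z hz w hw => le_antisymm ?_ ?_⟩
  · refine iSup_le fun g => ENNReal.ofReal_le_ofReal ?_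
    exact poincareDist_comp_le (f := fun z => g.1 (φ z)) (g.2.1.comp hφ.1 hφ.2)
      (g.2.2.comp hφ.2) (mem_ball_zero_iff.mp hz) (mem_ball_zero_iff.mp hw)
  · have h1 := (ENNReal.continuous_ofReal.tendsto _).comp
      (tendsto_poincareDist (mem_ball_zero_iff.mp hz) (mem_ball_zero_iff.mp hw) (hlim z hz)
        (hlim w hw))
    refine le_of_tendsto h1 ?_
    filter_upwards [self_mem_nhdsWithin] with ε hε
    exact le_iSup (fun g : {g : (Fin n → ℂ) → ℂ // DifferentiableOn ℂ g D ∧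
      Set.MapsTo g D (Metric.ball 0 1)} => ENNReal.ofReal
        (poincareDist (g.1 (φ z)) (g.1 (φ w)))) ⟨f ε, hfd ε hε, hfm ε hε⟩

theorem mainTheorem2 {n : ℕ} (D : Set (Fin n → ℂ)) (hD : IsConvexTube D) (hDt : IsTaut D)
    (φ : ℂ → Fin n → ℂ) (hφ : IsHolomorphicDisc D φ) :
    IsComplexGeodesic D φ ↔
      ∃ h : ℂ → Fin n → ℂ,
        (∃ (a : Fin n → ℂ) (b : Fin n → ℝ), ∀ (z : ℂ) (j : Fin n),
          h z j = starRingEnd ℂ (a j) * z ^ 2 + (b j : ℂ) * z + a j) ∧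
        (∀ᵐ ζ ∂circleLebesgue, ∃ w : Fin n → ℂ, HasRadialLimit φ ζ w ∧
          ∀ z ∈ D, (starRingEnd ℂ ζ * (h ζ ⬝ᵥ (z - w))).re < 0) ∧
        (∀ z ∈ Metric.ball (0 : ℂ) 1, z ≠ 0 →
          (h z ⬝ᵥ (z⁻¹ • (φ 0 - φ z))).re < 0) :=
  ⟨fun hg => hg.exists_quadratic hD (hφ.ae_exists_hasRadialLimit hD hDt),
    fun ⟨_, ⟨a, b, hh⟩, hi, hii⟩ => hφ.isComplexGeodesic_of_quadratic hD.isOpen a b hh hi hii⟩
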